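/- Let $\mathcal K$ be an augmented virtual double category in the sense of Koudenburg: it has objects, a category of vertical morphisms, horizontal morphisms $J\colon A\nrightarrow B$, and cells whose horizontal source is a possibly empty path of horizontal morphisms and whose horizontal target is either a single horizontal morphism (unary cells) or an object (nullary cells), with associative and unital vertical composition $\psi\circ(\phi_1,\dots,\phi_n)$. For nullary cells $\phi,\psi$ with target $M$ such that the vertical target of $\phi$ is the vertical source of $\psi$, write $\phi\odot\psi=\mathrm{id}_M\circ(\phi,\psi)$. A vertical cell is a nullary cell with empty horizontal source. A cell $\psi\colon J\Rightarrow K$, with $J$ of length at most one and with vertical source $f$ and target $g$, is *cartesian* if every cell $\chi\colon \underline H\Rightarrow K$ with vertical source $f\circ h$ and target $g\circ k$ factors uniquely as $\chi=\psi\circ(\phi)$ with $\phi\colon\underline H\Rightarrow J$ having vertical source $h$ and target $k$. When $J$ is a horizontal morphism it is then called the restriction $K(f,g)$ of $K$; the *companion* $f_*\colon A\nrightarrow C$ of $f\colon A\to C$ is the restriction $C(f,\mathrm{id})$. A nullary cell $\eta\colon \underline J\Rightarrow M$ with vertical source $d$ and vertical target $l$ is *left Kan*, defining $l$ as the left Kan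 extension of $d$ along $\underline J$, if every nullary cell with horizontal source $\underline J$ followed by any (possibly empty) path $\underline H$, with horizontal target $M$ and with vertical source $d$, factors uniquely as $\eta\odot\phi'$; it is *weakly left Kan* if this holds for $\underline H$ empty. For a single $J\colon A\nrightarrow B$ and $f\colon X\to B$, the (weak) left Kan extension of $d$ along $J$ *restricts along* $f$ if the restriction $J(\mathrm{id},f)$ exists and, for any (weakly) left Kan cell $\eta\colon J\Rightarrow M$ with vertical source $d$, its composite with the cartesian cell $J(\mathrm{id},f)\Rightarrow J$ is again (weakly) left Kan. A (weakly) left Kan cell $\eta\colon J\Rightarrow M$ is *pointwise* if its composite with the cartesian cell defining $J(\mathrm{id},f)$ is again (weakly) left Kan, for every $f$ for which the restriction $J(\mathrm{id},f)$ exists. A vertical morphism $f\colon M\to N$ is *(weakly) total* if for every $J\colon M\nrightarrow B$ the pointwise (weak) left Kan extension of $f$ along $J$ exists. A cell $\phi\colon J\Rightarrow K$ between horizontal morphisms with $K\colon M\nrightarrow B$ is *pointwise (weakly) left $f$-exact* if for every pointwise (weakly) left Kan cell $\eta\colon K\Rightarrow N$ with vertical source $f$ the composite $\eta\circ\phi$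 is again pointwise (weakly) left Kan. A vertical morphism $y\colon M\to \widehat M$ is a *(weak) Yoneda morphism* if every cartesian cell $J\Rightarrow \widehat M$, with $J$ any horizontal morphism out of $M$ and with vertical source $y$, is (weakly) left Kan and, for every $J\colon M\nrightarrow B$, there is a vertical morphism $J^\lambda\colon B\to \widehat M$ together with a cartesian cell $J\Rightarrow\widehat M$ with vertical source $y$ and vertical target $J^\lambda$. **Theorem.** Each of the following holds in two parallel versions: one in which all words "(weak)" and "(weakly)" are omitted, and one in which they are all kept; the word "weak" without parentheses is kept in both. For a vertical morphism $f\colon M\to N$ the following are equivalent: (a) $f$ is (weakly) total; (b) for all $J\colon A\nrightarrow B$, $d\colon A\to M$ and $K\colon M\nrightarrow B$: if there exists a pointwise (weakly) left $f$-exact cell $\phi\colon J\Rightarrow K$ with vertical source $d$ and vertical target $\mathrm{id}_B$, then the pointwise (weak) left Kan extension of $f\circ d$ along $J$ exists. If moreover a (weak) Yoneda morphism $y\colon M\to\widehat M$ and the companions $y_*\colon M\nrightarrow \widehat M$ and $f_*\colon M\nrightarrow N$ exist, let $(f_*)^\lambda\colon N\to\widehat M$ be any vertical morphism for which there is a cartesian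 cell $f_*\Rightarrow\widehat M$ with vertical source $y$ and vertical target $(f_*)^\lambda$. Then (a) and (b) are further equivalent to each of the following: (c) the weak left Kan extension of $f$ along $y_*$ exists and restricts along $(f_*)^\lambda$; (d) $(f_*)^\lambda$ has a left adjoint $z\colon\widehat M\to N$, in the $2$-category of objects, vertical morphisms and vertical cells of $\mathcal K$; and in that case the weak left Kan extension of (c) and the left adjoint of (d) coincide: a vertical morphism $z\colon\widehat M\to N$ is a weak left Kan extension of $f$ along $y_*$ if and only if it is a left adjoint of $(f_*)^\lambda$. -/

import Mathlib

open CategoryTheory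

universe u v w x

namespace AVDC

/-! ### Paths of horizontal morphisms -/

/-- (Possibly empty) paths `(J₁, …, Jₙ)` of horizontal morphisms. -/
inductive HPath {Ob : Type u} (Hor : Ob → Ob → Type w) : Ob → Ob → Type (max u w)
  | nil (A : Ob) : HPath Hor A A
  | cons {A B C : Ob} (J : Hor A B) (p : HPath Hor B C) : HPath Hor A C

namespace HPath

/-- The path consisting of a single horizontal morphism. -/
abbrev single {Ob : Type u} {Hor : Ob → Ob → Type w} {A B : Ob} (J : Hor A B) : HPath Hor A B :=
  cons J (nil B)

/-- Concatenation of paths. -/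
def append {Ob : Type u} {Hor : Ob → Ob → Type w} :
    {A B C : Ob} → HPath Hor A B → HPath Hor B C → HPath Hor A C
  | _, _, _, nil _, q => q
  | _, _, _, cons J p, q => cons J (append p q)

theorem append_nil {Ob : Type u} {Hor : Ob → Ob → Type w} :
    {A B : Ob} → (p : HPath Hor A B) → p.append (nil B) = p
  | _, _, nil _ => rfl
  | _, _, cons J p => congrArg (cons J) (append_nil p)

theorem append_assoc {Ob : Type u} {Hor : Ob → Ob → Type w} :
    {A B C D : Ob} → (p : HPath Hor A B) → (q : HPath Hor B C) → (r : HPath Hor C D) →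
      (p.append q).append r = p.append (q.append r)
  | _, _, _, _, nil _, _, _ => rfl
  | _, _, _, _, cons J p, q, r => congrArg (cons J) (append_assoc p q r)

end HPath

/-- Paths of length at most one: the empty path at an object `C` (written `C` on paper) or a single
horizontal morphism. These are the horizontal targets of cells: cells with target `null C` are
called nullary, those with target `un K` unary. -/
inductive HTarget {Ob : Type u} (Hor : Ob → Ob → Type w) : Ob → Ob → Type (max u w)
  | null (C : Ob) : HTarget Hor C C
  | un {C D : Ob} (K : Hor C D) : HTarget Hor C D

/-- A path of length at most one regarded as a path. -/
abbrev HTarget.toPath {Ob : Type u} {Hor : Ob → Ob → Type w} :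
    {C D : Ob} → HTarget Hor C D → HPath Hor C D
  | _, _, .null C => HPath.nil C
  | _, _, .un K => HPath.single K

/-! ### Augmented virtual double categories -/

/-- The horizontal morphisms and the cells of an augmented virtual double category. The objects
and vertical morphisms are those of the category `Ob`. The type `Cell J f g K` consists of the
cells with horizontal source the path `J`, vertical source `f` (drawn on the left), vertical
target `g` (drawn on the right) and horizontal target `K`. -/
class Cells (Ob : Type u) [Category.{v} Ob] where
  Hor : Ob → Ob → Type w
  Cell : {A B C D : Ob} → HPath Hor A B → (A ⟶ C) → (B ⟶ D) → HTarget Hor C D → Type x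

open Cells (Hor Cell)

/-- Paths of cells `(φ₁, …, φₙ)`, each cell `φᵢ` having as vertical source the vertical target of
its predecessor. Such a path is indexed by the concatenation `J` of the horizontal sources, the
vertical source `f` of `φ₁`, the vertical target `g` of `φₙ` and the concatenation `K` of the
horizontal targets. The case `n = 0` is the empty path at a vertical morphism `f`. The equations
in `cons` only serve to avoid transports along equalities of paths. -/
inductive CellPath {Ob : Type u} [Category.{v} Ob] [Cells.{u, v, w, x} Ob] :
    {A B C D : Ob} → HPath (Ob := Ob) Hor A B → (A ⟶ C) → (B ⟶ D) → HPath (Ob := Ob) Hor C D →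
      Type (max u v w x)
  | nil {A C : Ob} (f : A ⟶ C) : CellPath (.nil A) f f (.nil C)
  | cons {A₀ A₁ A₂ C₀ C₁ C₂ : Ob} {f₀ : A₀ ⟶ C₀} {f₁ : A₁ ⟶ C₁} {f₂ : A₂ ⟶ C₂}
      {J : HPath (Ob := Ob) Hor A₀ A₁} {K : HTarget (Ob := Ob) Hor C₀ C₁}
      {J' : HPath (Ob := Ob) Hor A₁ A₂} {K' : HPath (Ob := Ob) Hor C₁ C₂}
      {P : HPath (Ob := Ob) Hor A₀ A₂} {Q : HPath (Ob := Ob) Hor C₀ C₂}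
      (φ : Cell J f₀ f₁ K) (φs : CellPath J' f₁ f₂ K')
      (hP : P = J.append J') (hQ : Q = K.toPath.append K') : CellPath P f₀ f₂ Q

namespace CellPath

/-- The path consisting of a single cell. -/
def single {Ob : Type u} [Category.{v} Ob] [Cells.{u, v, w, x} Ob] {A B C D : Ob}
    {J : HPath (Ob := Ob) Hor A B} {f : A ⟶ C} {g : B ⟶ D} {K : HTarget (Ob := Ob) Hor C D}
    (φ : Cell J f g K) : CellPath J f g K.toPath :=
  cons φ (nil g) (HPath.append_nil J).symm (HPath.append_nil K.toPath).symm

/-- Transport of a path of cells along equalities of its horizontal source and target. -/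
def cast {Ob : Type u} [Category.{v} Ob] [Cells.{u, v, w, x} Ob] {A B C D : Ob}
    {J J' : HPath (Ob := Ob) Hor A B} {f : A ⟶ C} {g : B ⟶ D} {K K' : HPath (Ob := Ob) Hor C D}
    (Φ : CellPath J f g K) (hJ : J' = J) (hK : K' = K) : CellPath J' f g K' :=
  match hJ, hK with
  | rfl, rfl => Φ

/-- Concatenation of paths of cells. -/
def append {Ob : Type u} [Category.{v} Ob] [Cells.{u, v, w, x} Ob] :
    {A₀ A₁ A₂ C₀ C₁ C₂ : Ob} → {f₀ : A₀ ⟶ C₀} → {f₁ : A₁ ⟶ C₁} → {f₂ : A₂ ⟶ C₂} →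
    {J : HPath (Ob := Ob) Hor A₀ A₁} → {K : HPath (Ob := Ob) Hor C₀ C₁} →
    {J' : HPath (Ob := Ob) Hor A₁ A₂} → {K' : HPath (Ob := Ob) Hor C₁ C₂} →
    CellPath J f₀ f₁ K → CellPath J' f₁ f₂ K' → CellPath (J.append J') f₀ f₂ (K.append K')
  | _, _, _, _, _, _, _, _, _, _, _, _, _, nil _, ψs => ψs
  | _, _, _, _, _, _, _, _, _, _, _, _, _, cons φ φs hP hQ, ψs =>
      cons φ (append φs ψs) (by rw [hP, HPath.append_assoc]) (by rw [hQ, HPath.append_assoc])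

end CellPath

/-- The operations of an augmented virtual double category: the vertical composite
`ψ ∘ (φ₁, …, φₙ)` of a path of cells with a cell, the horizontal identity cells `id_J` and the
vertical identity cells `id_f`. The vertical source and target of `ψ ∘ (φ₁, …, φₙ)` are the
composites `u = f ≫ h` and `v = g ≫ k`; the equations are arguments of `comp` only to avoid
transports. The composite of the empty path at `f` with `ψ` stands for `ψ ∘ (id_f)`. -/
class Ops (Ob : Type u) [Category.{v} Ob] extends Cells.{u, v, w, x} Ob where
  comp : {A B C D E F : Ob} → {J : HPath Hor A B} → {f : A ⟶ C} → {g : B ⟶ D} →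
    {K : HPath Hor C D} → {h : C ⟶ E} → {k : D ⟶ F} → {L : HTarget Hor E F} →
    CellPath J f g K → Cell K h k L → (u : A ⟶ E) → (v : B ⟶ F) → f ≫ h = u → g ≫ k = v →
    Cell J u v L
  hid : {A B : Ob} → (J : Hor A B) → Cell (.single J) (𝟙 A) (𝟙 B) (.un J)
  vid : {A C : Ob} → (f : A ⟶ C) → Cell (.nil A) f f (.null C)

open Ops (comp hid vid)

/-- The path `(id_{J₁}, …, id_{Jₙ})` of identity cells (empty if `n = 0`). -/
def idPath {Ob : Type u} [Category.{v} Ob] [Ops.{u, v, w, x} Ob] :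
    {A B : Ob} → (J : HPath (Ob := Ob) Hor A B) → CellPath J (𝟙 A) (𝟙 B) J
  | _, _, .nil A => .nil (𝟙 A)
  | _, _, .cons J p => .cons (hid J) (idPath p) rfl rfl

/-- The identity cell of a path of length at most one: `id_K` for a horizontal morphism `K` and
`id_C = id_{𝟙 C}` for the empty path at `C`. -/
def idTarget {Ob : Type u} [Category.{v} Ob] [Ops.{u, v, w, x} Ob] :
    {C D : Ob} → (K : HTarget (Ob := Ob) Hor C D) → Cell K.toPath (𝟙 C) (𝟙 D) K
  | _, _, .null C => vid (𝟙 C)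
  | _, _, .un K => hid K

/-- Two-layered vertically composable configurations: paths `(Φ₁, ψ₁), …, (Φₙ, ψₙ)` in which each
`Φᵢ` is a path of cells whose concatenated horizontal target is the horizontal source of `ψᵢ`. -/
inductive Layers {Ob : Type u} [Category.{v} Ob] [Cells.{u, v, w, x} Ob] :
    {A B C D E F : Ob} → HPath (Ob := Ob) Hor A B → (A ⟶ C) → (B ⟶ D) →
      HPath (Ob := Ob) Hor C D → (C ⟶ E) → (D ⟶ F) → HPath (Ob := Ob) Hor E F →
      Type (max u v w x)
  | nil {A C E : Ob} (f : A ⟶ C) (h : C ⟶ E) : Layers (.nil A) f f (.nil C) h h (.nil E)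
  | cons {A₀ A₁ A₂ C₀ C₁ C₂ E₀ E₁ E₂ : Ob} {f₀ : A₀ ⟶ C₀} {f₁ : A₁ ⟶ C₁} {f₂ : A₂ ⟶ C₂}
      {h₀ : C₀ ⟶ E₀} {h₁ : C₁ ⟶ E₁} {h₂ : C₂ ⟶ E₂}
      {J : HPath (Ob := Ob) Hor A₀ A₁} {K : HPath (Ob := Ob) Hor C₀ C₁}
      {L : HTarget (Ob := Ob) Hor E₀ E₁}
      {J' : HPath (Ob := Ob) Hor A₁ A₂} {K' : HPath (Ob := Ob) Hor C₁ C₂}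
      {L' : HPath (Ob := Ob) Hor E₁ E₂}
      {P : HPath (Ob := Ob) Hor A₀ A₂} {Q : HPath (Ob := Ob) Hor C₀ C₂}
      {R : HPath (Ob := Ob) Hor E₀ E₂}
      (Φ : CellPath J f₀ f₁ K) (ψ : Cell K h₀ h₁ L) (rest : Layers J' f₁ f₂ K' h₁ h₂ L')
      (hP : P = J.append J') (hQ : Q = K.append K') (hR : R = L.toPath.append L') :
      Layers P f₀ f₂ Q h₀ h₂ R

namespace Layers

/-- The concatenation `Φ₁ ⌢ ⋯ ⌢ Φₙ` of the upper layer. -/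
def upper {Ob : Type u} [Category.{v} Ob] [Cells.{u, v, w, x} Ob] :
    {A B C D E F : Ob} → {J : HPath (Ob := Ob) Hor A B} → {f : A ⟶ C} → {g : B ⟶ D} →
    {K : HPath (Ob := Ob) Hor C D} → {h : C ⟶ E} → {k : D ⟶ F} →
    {L : HPath (Ob := Ob) Hor E F} → Layers J f g K h k L → CellPath J f g K
  | _, _, _, _, _, _, _, _, _, _, _, _, _, nil f _ => .nil f
  | _, _, _, _, _, _, _, _, _, _, _, _, _, cons Φ _ rest hP hQ _ =>
      (Φ.append rest.upper).cast hP hQ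

/-- The lower layer `(ψ₁, …, ψₙ)`. -/
def lower {Ob : Type u} [Category.{v} Ob] [Cells.{u, v, w, x} Ob] :
    {A B C D E F : Ob} → {J : HPath (Ob := Ob) Hor A B} → {f : A ⟶ C} → {g : B ⟶ D} →
    {K : HPath (Ob := Ob) Hor C D} → {h : C ⟶ E} → {k : D ⟶ F} →
    {L : HPath (Ob := Ob) Hor E F} → Layers J f g K h k L → CellPath K h k L
  | _, _, _, _, _, _, _, _, _, _, _, _, _, nil _ h => .nil h
  | _, _, _, _, _, _, _, _, _, _, _, _, _, cons _ ψ rest _ hQ hR =>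
      .cons ψ rest.lower hQ hR

/-- The path of composites `(ψ₁ ∘ Φ₁, …, ψₙ ∘ Φₙ)`. -/
def composite {Ob : Type u} [Category.{v} Ob] [Ops.{u, v, w, x} Ob] :
    {A B C D E F : Ob} → {J : HPath (Ob := Ob) Hor A B} → {f : A ⟶ C} → {g : B ⟶ D} →
    {K : HPath (Ob := Ob) Hor C D} → {h : C ⟶ E} → {k : D ⟶ F} →
    {L : HPath (Ob := Ob) Hor E F} → Layers J f g K h k L → CellPath J (f ≫ h) (g ≫ k) L
  | _, _, _, _, _, _, _, _, _, _, _, _, _, nil f h => .nil (f ≫ h)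
  | _, _, _, _, _, _, _, _, _, _, _, _, _, cons Φ ψ rest hP _ hR =>
      .cons (comp Φ ψ _ _ rfl rfl) rest.composite hP hR

end Layers

end AVDC

open AVDC in
/-- An augmented virtual double category with objects and vertical morphisms those of the category
`Ob`: vertical composition of cells is associative and unital, vertical identity cells are
preserved by vertical composition, and vertical identity cells may be omitted from (and inserted
in) the path of cells that is being composed with another cell. -/
class AugmentedVirtualDoubleCategory (Ob : Type u) [Category.{v} Ob] extends
    Ops.{u, v, w, x} Ob where
  /-- `χ ∘ (ψ₁ ∘ Φ₁, …, ψₙ ∘ Φₙ) = (χ ∘ (ψ₁, …, ψₙ)) ∘ (Φ₁ ⌢ ⋯ ⌢ Φₙ)` -/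
  assoc : ∀ {A B C D E F G H : Ob} {J : HPath Hor A B} {f : A ⟶ C} {g : B ⟶ D}
    {K : HPath Hor C D} {h : C ⟶ E} {k : D ⟶ F} {L : HPath Hor E F} {p : E ⟶ G} {q : F ⟶ H}
    {M : HTarget Hor G H} (T : Layers J f g K h k L) (χ : Cell L p q M) (s : A ⟶ G) (t : B ⟶ H)
    (hs : (f ≫ h) ≫ p = s) (ht : (g ≫ k) ≫ q = t),
    comp T.composite χ s t hs ht =
      comp T.upper (comp T.lower χ (h ≫ p) (k ≫ q) rfl rfl) s t
        (by rw [← hs, Category.assoc]) (by rw [← ht, Category.assoc])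
  /-- `id_K ∘ (φ) = φ` for unary `φ` and `id_C ∘ (φ) = φ` for nullary `φ` -/
  id_comp : ∀ {A B C D : Ob} {J : HPath Hor A B} {f : A ⟶ C} {g : B ⟶ D} {K : HTarget Hor C D}
    (φ : Cell J f g K),
    comp (.single φ) (idTarget K) f g (Category.comp_id f) (Category.comp_id g) = φ
  /-- `φ ∘ (id_{J₁}, …, id_{Jₙ}) = φ`, and `φ ∘ (id_A) = φ` if `n = 0` -/
  comp_id : ∀ {A B C D : Ob} {J : HPath Hor A B} {f : A ⟶ C} {g : B ⟶ D} {K : HTarget Hor C D}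
    (φ : Cell J f g K),
    comp (idPath J) φ f g (Category.id_comp f) (Category.id_comp g) = φ
  /-- `id_h ∘ (id_f) = id_{h ∘ f}` -/
  vid_comp : ∀ {A C E : Ob} (f : A ⟶ C) (h : C ⟶ E),
    comp (.single (vid f)) (vid h) (f ≫ h) (f ≫ h) rfl rfl = vid (f ≫ h)
  /-- `ψ ∘ (φ₁, …, φᵢ, id_f, φᵢ₊₁, …, φₙ) = ψ ∘ (φ₁, …, φₙ)` -/
  comp_vid : ∀ {A₀ A₁ A₂ C₀ C₁ C₂ E F : Ob} {f₀ : A₀ ⟶ C₀} {f : A₁ ⟶ C₁} {f₂ : A₂ ⟶ C₂}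
    {J : HPath Hor A₀ A₁} {K : HPath Hor C₀ C₁} {J' : HPath Hor A₁ A₂} {K' : HPath Hor C₁ C₂}
    {h : C₀ ⟶ E} {k : C₂ ⟶ F} {L : HTarget Hor E F}
    (Φ : CellPath J f₀ f K) (Φ' : CellPath J' f f₂ K') (ψ : Cell (K.append K') h k L)
    (s : A₀ ⟶ E) (t : A₂ ⟶ F) (hs : f₀ ≫ h = s) (ht : f₂ ≫ k = t),
    comp (Φ.append (.cons (vid f) Φ' rfl rfl)) ψ s t hs ht = comp (Φ.append Φ') ψ s t hs ht

namespace AVDC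

open Cells (Hor Cell)
open Ops (comp hid vid)

/-- Cells with horizontal source the single morphism `J` and horizontal target the object `M`. -/
abbrev NullaryCell {Ob : Type u} [Category.{v} Ob] [AugmentedVirtualDoubleCategory.{u, v, w, x} Ob]
    {A B M : Ob} (J : Hor A B) (d : A ⟶ M) (l : B ⟶ M) : Type x :=
  Cell (.single J) d l (.null M)

/-- Cells with horizontal source and target the single morphisms `J` and `K`. -/
abbrev UnaryCell {Ob : Type u} [Category.{v} Ob] [AugmentedVirtualDoubleCategory.{u, v, w, x} Ob]
    {A B C D : Ob} (J : Hor A B) (f : A ⟶ C) (g : B ⟶ D) (K : Hor C D) : Type x :=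
  Cell (.single J) f g (.un K)

/-- Vertical cells `f ⇒ g`, i.e. cells with empty horizontal source and target. -/
abbrev VCell {Ob : Type u} [Category.{v} Ob] [AugmentedVirtualDoubleCategory.{u, v, w, x} Ob]
    {A C : Ob} (f g : A ⟶ C) : Type x :=
  Cell (.nil A) f g (.null C)

/-- The vertical composite `ψ ∘ (φ)` of two cells. -/
def vcomp {Ob : Type u} [Category.{v} Ob] [AugmentedVirtualDoubleCategory.{u, v, w, x} Ob]
    {A B C D E F : Ob} {J : HPath (Ob := Ob) Hor A B} {f : A ⟶ C} {g : B ⟶ D}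
    {K : HTarget (Ob := Ob) Hor C D} {h : C ⟶ E} {k : D ⟶ F} {L : HTarget (Ob := Ob) Hor E F}
    (φ : Cell J f g K) (ψ : Cell K.toPath h k L) (s : A ⟶ E) (t : B ⟶ F)
    (hs : f ≫ h = s := by simp) (ht : g ≫ k = t := by simp) : Cell J s t L :=
  comp (.single φ) ψ s t hs ht

/-- The horizontal composite `φ ⊙ ψ = id_M ∘ (φ, ψ)` of two nullary cells. -/
def hcomp {Ob : Type u} [Category.{v} Ob] [AugmentedVirtualDoubleCategory.{u, v, w, x} Ob]
    {A B C M : Ob} {J : HPath (Ob := Ob) Hor A B} {H : HPath (Ob := Ob) Hor B C}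
    {P : HPath (Ob := Ob) Hor A C} {f : A ⟶ M} {g : B ⟶ M} {h : C ⟶ M}
    (φ : Cell J f g (.null M)) (ψ : Cell H g h (.null M)) (hP : P = J.append H) :
    Cell P f h (.null M) :=
  comp (.cons φ (.single ψ) hP rfl) (vid (𝟙 M)) f h (Category.comp_id f) (Category.comp_id h)

/-- A cell `ψ : J ⇒ K`, with `J` a path of length at most one, is cartesian if every cell
`χ : H ⇒ K` with vertical source `f ∘ h` and vertical target `g ∘ k` factors uniquely as
`χ = ψ ∘ (φ)`, with `φ : H ⇒ J` having vertical source `h` and vertical target `k`. -/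
def IsCartesian {Ob : Type u} [Category.{v} Ob] [AugmentedVirtualDoubleCategory.{u, v, w, x} Ob]
    {A B C D : Ob} {J : HTarget (Ob := Ob) Hor A B} {f : A ⟶ C} {g : B ⟶ D}
    {K : HTarget (Ob := Ob) Hor C D} (ψ : Cell J.toPath f g K) : Prop :=
  ∀ {X Y : Ob} (H : HPath (Ob := Ob) Hor X Y) (h : X ⟶ A) (k : Y ⟶ B)
    (χ : Cell H (h ≫ f) (k ≫ g) K),
    ∃! φ : Cell H h k J, vcomp φ ψ (h ≫ f) (k ≫ g) = χ

/-- `ψ` is a cartesian unary cell, thus defining `J` as the restriction `K(f, g)`. -/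
def IsUnaryCartesian {Ob : Type u} [Category.{v} Ob]
    [AugmentedVirtualDoubleCategory.{u, v, w, x} Ob] {A B C D : Ob} {J : Hor A B} {f : A ⟶ C}
    {g : B ⟶ D} {K : Hor C D} (ψ : UnaryCell J f g K) : Prop :=
  IsCartesian (J := .un J) ψ

/-- `ψ` is a cartesian nullary cell, thus defining `J` as the restriction `M(f, g)`. -/
def IsNullaryCartesian {Ob : Type u} [Category.{v} Ob]
    [AugmentedVirtualDoubleCategory.{u, v, w, x} Ob] {A B M : Ob} {J : Hor A B} {f : A ⟶ M}
    {g : B ⟶ M} (ψ : NullaryCell J f g) : Prop :=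
  IsCartesian (J := .un J) ψ

/-- The cell `ψ` defines `J` as the companion of `f`, that is as the restriction `C(f, id)`. -/
def IsCompanionCell {Ob : Type u} [Category.{v} Ob]
    [AugmentedVirtualDoubleCategory.{u, v, w, x} Ob] {A C : Ob} {f : A ⟶ C} {J : Hor A C}
    (ψ : NullaryCell J f (𝟙 C)) : Prop :=
  IsNullaryCartesian ψ

/-! ### Left Kan extensions -/

/-- `η` is weakly left Kan: it defines `l` as the weak left Kan extension of `d` along the
path `J`. -/
def IsWeaklyLeftKan {Ob : Type u} [Category.{v} Ob]
    [AugmentedVirtualDoubleCategory.{u, v, w, x} Ob] {A B M : Ob} {J : HPath (Ob := Ob) Hor A B}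
    {d : A ⟶ M} {l : B ⟶ M} (η : Cell J d l (.null M)) : Prop :=
  ∀ (k : B ⟶ M) (φ : Cell J d k (.null M)),
    ∃! φ' : VCell l k, hcomp η φ' (HPath.append_nil J).symm = φ

/-- `η` is left Kan: it defines `l` as the left Kan extension of `d` along the path `J`. -/
def IsLeftKan {Ob : Type u} [Category.{v} Ob]
    [AugmentedVirtualDoubleCategory.{u, v, w, x} Ob] {A B M : Ob} {J : HPath (Ob := Ob) Hor A B}
    {d : A ⟶ M} {l : B ⟶ M} (η : Cell J d l (.null M)) : Prop :=
  ∀ {Y : Ob} (H : HPath (Ob := Ob) Hor B Y) (k : Y ⟶ M) (φ : Cell (J.append H) d k (.null M)),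
    ∃! φ' : Cell H l k (.null M), hcomp η φ' rfl = φ

/-- The notions below come in two parallel versions: the ordinary one and the weak one. -/
inductive Variant
  | ordinary
  | weak

/-- `η` is left Kan (ordinary version) or weakly left Kan (weak version). -/
def IsKan {Ob : Type u} [Category.{v} Ob] [AugmentedVirtualDoubleCategory.{u, v, w, x} Ob]
    (κ : Variant) {A B M : Ob} {J : HPath (Ob := Ob) Hor A B} {d : A ⟶ M} {l : B ⟶ M}
    (η : Cell J d l (.null M)) : Prop :=
  match κ with
  | .ordinary => IsLeftKan η
  | .weak => IsWeaklyLeftKan η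

/-- The weak left Kan extension of `d` along `J` exists. -/
def WeakLeftKanExists {Ob : Type u} [Category.{v} Ob]
    [AugmentedVirtualDoubleCategory.{u, v, w, x} Ob] {A B M : Ob} (d : A ⟶ M) (J : Hor A B) :
    Prop :=
  ∃ (l : B ⟶ M) (η : NullaryCell J d l), IsWeaklyLeftKan η

/-- The weak left Kan extension of `d` along `J` restricts along `f`: the restriction `J(id, f)`
exists and, for any weakly left Kan cell `η` defining the extension and any cartesian cell `c`
defining the restriction, the composite `η ∘ c` is weakly left Kan. -/
def WeakLeftKanRestrictsAlong {Ob : Type u} [Category.{v} Ob]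
    [AugmentedVirtualDoubleCategory.{u, v, w, x} Ob] {A B M X : Ob} (d : A ⟶ M) (J : Hor A B)
    (f : X ⟶ B) : Prop :=
  (∃ (J' : Hor A X) (c : UnaryCell J' (𝟙 A) f J), IsUnaryCartesian c) ∧
    ∀ (l : B ⟶ M) (η : NullaryCell J d l), IsWeaklyLeftKan η →
      ∀ (J' : Hor A X) (c : UnaryCell J' (𝟙 A) f J), IsUnaryCartesian c →
        IsWeaklyLeftKan (vcomp c η d (f ≫ l))

/-- `η` is pointwise (weakly) left Kan: it is (weakly) left Kan and so is its composite with every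
cartesian cell that defines a restriction of the form `J(id, f)`. -/
def IsPointwiseKan {Ob : Type u} [Category.{v} Ob]
    [AugmentedVirtualDoubleCategory.{u, v, w, x} Ob] (κ : Variant) {A B M : Ob} {J : Hor A B}
    {d : A ⟶ M} {l : B ⟶ M} (η : NullaryCell J d l) : Prop :=
  IsKan κ η ∧
    ∀ {X : Ob} (f : X ⟶ B) (J' : Hor A X) (c : UnaryCell J' (𝟙 A) f J), IsUnaryCartesian c →
      IsKan κ (vcomp c η d (f ≫ l))

/-- The pointwise (weak) left Kan extension of `d` along `J` exists. -/
def PointwiseKanExists {Ob : Type u} [Category.{v} Ob]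
    [AugmentedVirtualDoubleCategory.{u, v, w, x} Ob] (κ : Variant) {A B M : Ob} (d : A ⟶ M)
    (J : Hor A B) : Prop :=
  ∃ (l : B ⟶ M) (η : NullaryCell J d l), IsPointwiseKan κ η

/-- `f` is (weakly) total. -/
def IsTotalMorphism {Ob : Type u} [Category.{v} Ob] [AugmentedVirtualDoubleCategory.{u, v, w, x} Ob]
    (κ : Variant) {M N : Ob} (f : M ⟶ N) : Prop :=
  ∀ (B : Ob) (J : Hor M B), PointwiseKanExists κ f J

/-- The cell `φ` is pointwise (weakly) left `f`-exact: for any pointwise (weakly) left Kan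
cell `η` with vertical source `f`, the composite `η ∘ φ` is pointwise (weakly) left Kan. -/
def IsPointwiseExact {Ob : Type u} [Category.{v} Ob]
    [AugmentedVirtualDoubleCategory.{u, v, w, x} Ob] (κ : Variant) {A B C D N : Ob} (f : C ⟶ N)
    {J : Hor A B} {d : A ⟶ C} {g : B ⟶ D} {K : Hor C D} (φ : UnaryCell J d g K) : Prop :=
  ∀ (l : D ⟶ N) (η : NullaryCell K f l), IsPointwiseKan κ η →
    IsPointwiseKan κ (vcomp φ η (d ≫ f) (g ≫ l))

/-! ### Yoneda morphisms and adjunctions -/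

/-- `f` is (weakly) dense: every cartesian nullary cell with vertical source `f` is (weakly)
left Kan. -/
def IsDense {Ob : Type u} [Category.{v} Ob] [AugmentedVirtualDoubleCategory.{u, v, w, x} Ob]
    (κ : Variant) {A M : Ob} (f : A ⟶ M) : Prop :=
  ∀ (B : Ob) (J : Hor A B) (l : B ⟶ M) (η : NullaryCell J f l), IsNullaryCartesian η → IsKan κ η

/-- `y` is a (weak) Yoneda morphism: it is (weakly) dense and every `J : A ⇸ B` is the
restriction of `P` along `y` and some vertical morphism `Jl : B ⟶ P`. -/
structure IsYoneda {Ob : Type u} [Category.{v} Ob]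
    [AugmentedVirtualDoubleCategory.{u, v, w, x} Ob] (κ : Variant) {A P : Ob} (y : A ⟶ P) :
    Prop where
  dense : IsDense κ y
  yoneda : ∀ (B : Ob) (J : Hor A B),
    ∃ (Jl : B ⟶ P) (γ : NullaryCell J y Jl), IsNullaryCartesian γ

/-- `z` is left adjoint to `g` in the 2-category of objects, vertical morphisms and vertical
cells. -/
def IsLeftAdjointTo {Ob : Type u} [Category.{v} Ob]
    [AugmentedVirtualDoubleCategory.{u, v, w, x} Ob] {N P : Ob} (z : P ⟶ N) (g : N ⟶ P) : Prop :=
  ∃ (ι : VCell (𝟙 P) (z ≫ g)) (ε : VCell (g ≫ z) (𝟙 N)),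
    hcomp (vcomp (vid g) ι g (g ≫ z ≫ g)) (vcomp ε (vid g) (g ≫ z ≫ g) g) rfl = vid g ∧
    hcomp (vcomp ι (vid z) z (z ≫ g ≫ z)) (vcomp (vid z) ε (z ≫ g ≫ z) z) rfl = vid z

end AVDC

open AVDC

namespace AVDC

open AVDC.Cells (Hor Cell)
open AVDC.Ops (comp hid vid)
open AugmentedVirtualDoubleCategory

section

variable {Ob : Type u} [Category.{v} Ob]

/-! Write `g` for $(f_*)^\lambda$, `P` for $\widehat M$. The cartesian cells `cf` and `γ` exhibit
$f_*$ both as $N(f,\mathrm{id})$ and as $P(y,g)$. Hence cells $H \Rightarrow N$ from $f$ to $k$ and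
cells $H \Rightarrow P$ from $y$ to $g\circ k$ are both the same as cells $H \Rightarrow f_*$ from
$\mathrm{id}$ to $k$. This transposition (`IsTranspose`) is natural under composition with cells on
the right and on top, and it carries the whole argument.

From Kan extension to adjoint (`isLeftAdjointTo_of_isWeaklyLeftKan`): if `ζ` defines $z$ as the weak
left Kan extension of $f$ along $y_*$, its transpose factors through the companion cell `cy`, which
is weakly left Kan by density; the factor is the unit. The restriction of $y_*$ along $g$ is $f_*$
again, so if `ζ` stays weakly left Kan on it, then `cf` factors through the restricted cell; the
factor is the counit. The triangle identities follow by cancelling Kan cells.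

From adjoint to Kan extension (`IsLeftAdjointTo.exists_isKan`): let $J = y_*(\mathrm{id},a)$. Cells
$J ⌢ H \Rightarrow N$ from $f$ to $k$ transpose to cells into $P$ from $y$ to $g\circ k$; by density
these are cells $H \Rightarrow P$ from $a$ to $g\circ k$, whose mates are cells $H \Rightarrow N$
from $z\circ a$ to $k$. So $z\circ a$ is the left Kan extension along $J$. By the Yoneda axiom every
$J$ out of $M$ has this form, so $f$ is total. The path $H$ is arbitrary throughout; the weak
version is the case of empty $H$.

Thus (a) and (c) each yield (d), while (d) yields both. The equivalence of (a) and (b) is formal: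
identity cells are exact. -/

theorem HPath.nil_append {A B : Ob} [Cells.{u, v, w, x} Ob] (p : HPath (Ob := Ob) Hor A B) :
    p = (HPath.nil A).append p := rfl

/-! ### Transports of paths of cells. -/

namespace CellPath

variable [Cells.{u, v, w, x} Ob]

theorem cast_cons {A₀ A₁ A₂ C₀ C₁ C₂ : Ob} {f₀ : A₀ ⟶ C₀} {f₁ : A₁ ⟶ C₁} {f₂ : A₂ ⟶ C₂}
    {J : HPath (Ob := Ob) Hor A₀ A₁} {K : HTarget (Ob := Ob) Hor C₀ C₁}
    {J' : HPath (Ob := Ob) Hor A₁ A₂} {K' : HPath (Ob := Ob) Hor C₁ C₂}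
    {P P' : HPath (Ob := Ob) Hor A₀ A₂} {Q Q' : HPath (Ob := Ob) Hor C₀ C₂}
    (φ : Cell J f₀ f₁ K) (φs : CellPath J' f₁ f₂ K') (hP : P = J.append J')
    (hQ : Q = K.toPath.append K') (hP' : P' = P) (hQ' : Q' = Q) :
    (cons φ φs hP hQ).cast hP' hQ' = cons φ φs (hP'.trans hP) (hQ'.trans hQ) := by
  subst hP' hQ'
  rfl

/-- Absorb the transports of the tail of a path of cells. -/
theorem cons_cast {A₀ A₁ A₂ C₀ C₁ C₂ : Ob} {f₀ : A₀ ⟶ C₀} {f₁ : A₁ ⟶ C₁} {f₂ : A₂ ⟶ C₂}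
    {J : HPath (Ob := Ob) Hor A₀ A₁} {K : HTarget (Ob := Ob) Hor C₀ C₁}
    {J' J'' : HPath (Ob := Ob) Hor A₁ A₂} {K' K'' : HPath (Ob := Ob) Hor C₁ C₂}
    {P : HPath (Ob := Ob) Hor A₀ A₂} {Q : HPath (Ob := Ob) Hor C₀ C₂}
    (φ : Cell J f₀ f₁ K) (φs : CellPath J' f₁ f₂ K') (hP : P = J.append J'')
    (hQ : Q = K.toPath.append K'') (hJ : J'' = J') (hK : K'' = K') :
    cons φ (φs.cast hJ hK) hP hQ = cons φ φs (hJ ▸ hP) (hK ▸ hQ) := by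
  subst hJ hK
  rfl

theorem append_nil {A B C D : Ob} {f : A ⟶ C} {g : B ⟶ D} {J : HPath (Ob := Ob) Hor A B}
    {K : HPath (Ob := Ob) Hor C D} (Φ : CellPath J f g K) :
    Φ.append (nil g) = Φ.cast (HPath.append_nil J) (HPath.append_nil K) := by
  induction Φ with
  | nil f => rfl
  | cons φ φs hP hQ ih => rw [append, ih, cons_cast, cast_cons]

theorem cast_cast {A B C D : Ob} {f : A ⟶ C} {g : B ⟶ D} {J J' J'' : HPath (Ob := Ob) Hor A B}
    {K K' K'' : HPath (Ob := Ob) Hor C D} (Φ : CellPath J f g K) (hJ : J' = J) (hK : K' = K)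
    (hJ' : J'' = J') (hK' : K'' = K') :
    (Φ.cast hJ hK).cast hJ' hK' = Φ.cast (hJ'.trans hJ) (hK'.trans hK) := by
  subst hJ hK hJ' hK'
  rfl

theorem append_cast {A₀ A₁ A₂ C₀ C₁ C₂ : Ob} {f₀ : A₀ ⟶ C₀} {f₁ : A₁ ⟶ C₁} {f₂ : A₂ ⟶ C₂}
    {J : HPath (Ob := Ob) Hor A₀ A₁} {K : HPath (Ob := Ob) Hor C₀ C₁}
    {J' J'' : HPath (Ob := Ob) Hor A₁ A₂} {K' K'' : HPath (Ob := Ob) Hor C₁ C₂}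
    (Φ : CellPath J f₀ f₁ K) (Ψ : CellPath J' f₁ f₂ K') (hJ : J'' = J') (hK : K'' = K') :
    Φ.append (Ψ.cast hJ hK) = (Φ.append Ψ).cast (by rw [hJ]) (by rw [hK]) := by
  subst hJ hK
  rfl

end CellPath

/-! ### Calculus of vertical and horizontal composition, with free boundary morphisms tied by
equations in place of transports. -/

variable [AugmentedVirtualDoubleCategory.{u, v, w, x} Ob]

/-- Associativity for a single column. -/
theorem comp_single_comp {A B C D E F G H : Ob} {J : HPath (Ob := Ob) Hor A B} {f : A ⟶ C}
    {g : B ⟶ D} {K : HPath (Ob := Ob) Hor C D} {h : C ⟶ E} {k : D ⟶ F}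
    {L : HTarget (Ob := Ob) Hor E F} {p : E ⟶ G} {q : F ⟶ H} {M : HTarget (Ob := Ob) Hor G H}
    (Φ : CellPath J f g K) (ψ : Cell K h k L) (χ : Cell L.toPath p q M)
    {s : A ⟶ E} {t : B ⟶ F} (hs : f ≫ h = s) (ht : g ≫ k = t)
    {s' : A ⟶ G} {t' : B ⟶ H} (hs' : s ≫ p = s') (ht' : t ≫ q = t')
    {m : C ⟶ G} {n : D ⟶ H} (hm : h ≫ p = m) (hn : k ≫ q = n) :
    comp (.single (comp Φ ψ s t hs ht)) χ s' t' hs' ht' =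
      comp Φ (comp (.single ψ) χ m n hm hn) s' t' (by rw [← hm, ← Category.assoc, hs, hs'])
        (by rw [← hn, ← Category.assoc, ht, ht']) := by
  subst hs ht hm hn
  have := assoc (Layers.cons Φ ψ (.nil g k) (HPath.append_nil J).symm (HPath.append_nil K).symm
    (HPath.append_nil L.toPath).symm) χ s' t' hs' ht'
  simp only [Layers.upper, CellPath.append_nil, CellPath.cast_cast] at this
  exact this

/-- Associativity for two adjacent columns. -/
theorem comp_pair_comp {A₀ A₁ A₂ C₀ C₁ C₂ E₀ E₁ E₂ G H : Ob} {f₀ : A₀ ⟶ C₀} {f₁ : A₁ ⟶ C₁}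
    {f₂ : A₂ ⟶ C₂} {h₀ : C₀ ⟶ E₀} {h₁ : C₁ ⟶ E₁} {h₂ : C₂ ⟶ E₂}
    {J : HPath (Ob := Ob) Hor A₀ A₁} {K : HPath (Ob := Ob) Hor C₀ C₁}
    {L : HTarget (Ob := Ob) Hor E₀ E₁}
    {J' : HPath (Ob := Ob) Hor A₁ A₂} {K' : HPath (Ob := Ob) Hor C₁ C₂}
    {L' : HTarget (Ob := Ob) Hor E₁ E₂}
    {P : HPath (Ob := Ob) Hor A₀ A₂} {Q : HPath (Ob := Ob) Hor C₀ C₂}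
    {R : HPath (Ob := Ob) Hor E₀ E₂} {p : E₀ ⟶ G} {q : E₂ ⟶ H} {M : HTarget (Ob := Ob) Hor G H}
    (Φ : CellPath J f₀ f₁ K) (ψ : Cell K h₀ h₁ L) (Φ' : CellPath J' f₁ f₂ K')
    (ψ' : Cell K' h₁ h₂ L') (χ : Cell R p q M)
    {s₀ : A₀ ⟶ E₀} {s₁ : A₁ ⟶ E₁} {s₂ : A₂ ⟶ E₂} (e₀ : f₀ ≫ h₀ = s₀) (e₁ : f₁ ≫ h₁ = s₁)
    (e₂ : f₂ ≫ h₂ = s₂) (hP : P = J.append J') (hR : R = L.toPath.append L'.toPath)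
    (hQ : Q = K.append K') {Ψ : CellPath P f₀ f₂ Q} (hΨ : (Φ.append Φ').cast hP hQ = Ψ)
    {s : A₀ ⟶ G} {t : A₂ ⟶ H} (hs : s₀ ≫ p = s) (ht : s₂ ≫ q = t)
    {m : C₀ ⟶ G} {n : C₂ ⟶ H} (hm : h₀ ≫ p = m) (hn : h₂ ≫ q = n) :
    comp (.cons (comp Φ ψ s₀ s₁ e₀ e₁) (.single (comp Φ' ψ' s₁ s₂ e₁ e₂)) hP hR) χ s t hs ht =
      comp Ψ (comp (.cons ψ (.single ψ') hQ hR) χ m n hm hn) s t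
        (by rw [← hm, ← Category.assoc, e₀, hs]) (by rw [← hn, ← Category.assoc, e₂, ht]) := by
  subst e₀ e₁ e₂ hm hn hΨ
  have := assoc (Layers.cons Φ ψ (.cons Φ' ψ' (.nil f₂ h₂) (HPath.append_nil J').symm
    (HPath.append_nil K').symm (HPath.append_nil L'.toPath).symm) hP hQ hR) χ s t hs ht
  simp only [Layers.upper, CellPath.append_nil, CellPath.cast_cast, CellPath.append_cast] at this
  exact this

theorem vcomp_assoc {A B C D E F G H : Ob} {J : HPath (Ob := Ob) Hor A B} {f : A ⟶ C}
    {g : B ⟶ D} {K : HTarget (Ob := Ob) Hor C D} {h : C ⟶ E} {k : D ⟶ F}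
    {L : HTarget (Ob := Ob) Hor E F} {p : E ⟶ G} {q : F ⟶ H} {M : HTarget (Ob := Ob) Hor G H}
    (φ : Cell J f g K) (ψ : Cell K.toPath h k L) (χ : Cell L.toPath p q M)
    {s : A ⟶ E} {t : B ⟶ F} (hs : f ≫ h = s) (ht : g ≫ k = t)
    {s' : A ⟶ G} {t' : B ⟶ H} (hs' : s ≫ p = s') (ht' : t ≫ q = t')
    {m : C ⟶ G} {n : D ⟶ H} (hm : h ≫ p = m) (hn : k ≫ q = n) :
    vcomp (vcomp φ ψ s t hs ht) χ s' t' hs' ht' =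
      vcomp φ (vcomp ψ χ m n hm hn) s' t' (by rw [← hm, ← Category.assoc, hs, hs'])
        (by rw [← hn, ← Category.assoc, ht, ht']) :=
  comp_single_comp ..

theorem vcomp_vid_id {A B C : Ob} {J : HPath (Ob := Ob) Hor A B} {f : A ⟶ C} {g : B ⟶ C}
    (φ : Cell J f g (.null C)) (hs : f ≫ 𝟙 C = f) (ht : g ≫ 𝟙 C = g) :
    vcomp φ (vid (𝟙 C)) f g hs ht = φ :=
  id_comp φ

theorem hid_vcomp {A B C D : Ob} {J : Hor A B} {f : A ⟶ C} {g : B ⟶ D}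
    {K : HTarget (Ob := Ob) Hor C D} (φ : Cell (.single J) f g K) (hs : 𝟙 A ≫ f = f)
    (ht : 𝟙 B ≫ g = g) : vcomp (hid J) φ f g hs ht = φ :=
  comp_id φ

theorem comp_cast_vid {A₀ A₁ A₂ C₀ C₁ C₂ E F : Ob} {f₀ : A₀ ⟶ C₀} {f : A₁ ⟶ C₁} {f₂ : A₂ ⟶ C₂}
    {J : HPath (Ob := Ob) Hor A₀ A₁} {K : HPath (Ob := Ob) Hor C₀ C₁}
    {J' : HPath (Ob := Ob) Hor A₁ A₂} {K' : HPath (Ob := Ob) Hor C₁ C₂}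
    {P : HPath (Ob := Ob) Hor A₀ A₂} {Q : HPath (Ob := Ob) Hor C₀ C₂}
    {h : C₀ ⟶ E} {k : C₂ ⟶ F} {L : HTarget (Ob := Ob) Hor E F}
    (Φ : CellPath J f₀ f K) (Φ' : CellPath J' f f₂ K') (hP : P = J.append J')
    (hQ : Q = K.append K') (ψ : Cell Q h k L)
    (s : A₀ ⟶ E) (t : A₂ ⟶ F) (hs : f₀ ≫ h = s) (ht : f₂ ≫ k = t) :
    comp ((Φ.append (.cons (vid f) Φ' rfl rfl)).cast hP hQ) ψ s t hs ht =
      comp ((Φ.append Φ').cast hP hQ) ψ s t hs ht := by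
  subst hP hQ
  exact comp_vid Φ Φ' ψ s t hs ht

/-- A vertical identity cell on the right of a single cell may be dropped. -/
theorem comp_cons_vid {A₀ A₁ C₀ C₁ E F : Ob} {f₀ : A₀ ⟶ C₀} {f : A₁ ⟶ C₁}
    {J : HPath (Ob := Ob) Hor A₀ A₁} {K : HTarget (Ob := Ob) Hor C₀ C₁}
    {h : C₀ ⟶ E} {k : C₁ ⟶ F}
    {L : HTarget (Ob := Ob) Hor E F} (φ : Cell J f₀ f K) (ψ : Cell K.toPath h k L)
    (s : A₀ ⟶ E) (t : A₁ ⟶ F) (hs : f₀ ≫ h = s) (ht : f ≫ k = t)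
    (hP : J = J.append (.nil A₁)) (hQ : K.toPath = K.toPath.append (.nil C₁)) :
    comp (.cons φ (.single (vid f)) hP hQ) ψ s t hs ht = vcomp φ ψ s t hs ht := by
  -- The identity cell is removed from between the path `φ` and an empty path.
  have := comp_cast_vid (.cons φ (.nil f) hP hQ) (.nil f) hP hQ ψ s t hs ht
  erw [CellPath.cast_cons, CellPath.cast_cons] at this
  exact this

/-- A vertical identity cell on the left of a single cell may be dropped. -/
theorem comp_vid_cons {A₀ A₁ C₀ C₁ E F : Ob} {f₀ : A₀ ⟶ C₀} {f : A₁ ⟶ C₁}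
    {J : HPath (Ob := Ob) Hor A₀ A₁} {K : HTarget (Ob := Ob) Hor C₀ C₁}
    {h : C₀ ⟶ E} {k : C₁ ⟶ F}
    {L : HTarget (Ob := Ob) Hor E F} (φ : Cell J f₀ f K) (ψ : Cell K.toPath h k L)
    (s : A₀ ⟶ E) (t : A₁ ⟶ F) (hs : f₀ ≫ h = s) (ht : f ≫ k = t) :
    comp (.cons (vid f₀) (.single φ) rfl rfl) ψ s t hs ht = vcomp φ ψ s t hs ht :=
  comp_vid (.nil f₀) (.single φ) ψ s t hs ht

theorem hcomp_vid {A B M : Ob} {J : HPath (Ob := Ob) Hor A B} {f : A ⟶ M} {g : B ⟶ M}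
    (φ : Cell J f g (.null M)) (hP : J = J.append (.nil B)) : hcomp φ (vid g) hP = φ :=
  (comp_cons_vid ..).trans (id_comp φ)

theorem vid_hcomp {A B M : Ob} {J : HPath (Ob := Ob) Hor A B} {f : A ⟶ M} {g : B ⟶ M}
    (φ : Cell J f g (.null M)) : hcomp (vid f) φ (HPath.nil_append J) = φ :=
  (comp_vid_cons ..).trans (id_comp φ)

theorem hcomp_assoc {A B C D M : Ob} {J : HPath (Ob := Ob) Hor A B} {H : HPath (Ob := Ob) Hor B C}
    {I : HPath (Ob := Ob) Hor C D} {P : HPath (Ob := Ob) Hor A C} {Q : HPath (Ob := Ob) Hor B D}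
    {R : HPath (Ob := Ob) Hor A D} {f : A ⟶ M} {g : B ⟶ M} {h : C ⟶ M} {k : D ⟶ M}
    (φ : Cell J f g (.null M)) (ψ : Cell H g h (.null M)) (χ : Cell I h k (.null M))
    (hP : P = J.append H) (hR : R = P.append I) (hQ : Q = H.append I) (hR' : R = J.append Q) :
    hcomp (hcomp φ ψ hP) χ hR = hcomp φ (hcomp ψ χ hQ) hR' := by
  subst hQ
  have e₁ := comp_pair_comp (.cons φ (.single ψ) hP rfl) (vid (𝟙 M)) (.single χ) (vid (𝟙 M))
    (vid (𝟙 M)) (Category.comp_id f) (Category.comp_id h) (Category.comp_id k) hR rfl rfl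
    (CellPath.cast_cons ..)
    (Category.comp_id f) (Category.comp_id k) (Category.comp_id _) (Category.comp_id _)
  have e₂ := comp_pair_comp (.single φ) (vid (𝟙 M)) (.cons ψ (.single χ) rfl rfl) (vid (𝟙 M))
    (vid (𝟙 M)) (Category.comp_id f) (Category.comp_id g) (Category.comp_id k) hR' rfl rfl
    (CellPath.cast_cons ..)
    (Category.comp_id f) (Category.comp_id k) (Category.comp_id _) (Category.comp_id _)
  rw [show comp (.single χ) (vid (𝟙 M)) h k (Category.comp_id h) (Category.comp_id k) = χ from
    id_comp χ] at e₁
  rw [show comp (.single φ) (vid (𝟙 M)) f g (Category.comp_id f) (Category.comp_id g) = φ from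
    id_comp φ] at e₂
  exact e₁.trans e₂.symm

/-- Composing adjacent pairs of nullary cells columnwise. -/
theorem hcomp_vcomp {A B D X Y Z Q : Ob} {K : HTarget (Ob := Ob) Hor A B}
    {K' : HTarget (Ob := Ob) Hor B D} {u : A ⟶ Q} {v : B ⟶ Q} {w : D ⟶ Q}
    {I : HPath (Ob := Ob) Hor X Y} {H : HPath (Ob := Ob) Hor Y Z} {P : HPath (Ob := Ob) Hor X Z}
    {R : HPath (Ob := Ob) Hor A D} {a : X ⟶ A} {b : Y ⟶ B} {c : Z ⟶ D}
    (χ : Cell I a b K) (σ : Cell K.toPath u v (.null Q)) (φ : Cell H b c K')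
    (τ : Cell K'.toPath v w (.null Q)) {s₀ : X ⟶ Q} {s₁ : Y ⟶ Q} {s₂ : Z ⟶ Q}
    (e₀ : a ≫ u = s₀) (e₁ : b ≫ v = s₁) (e₂ : c ≫ w = s₂) (hP : P = I.append H)
    (hR : R = K.toPath.append K'.toPath) :
    hcomp (vcomp χ σ s₀ s₁ e₀ e₁) (vcomp φ τ s₁ s₂ e₁ e₂) hP =
      comp (.cons χ (.single φ) hP hR) (hcomp σ τ hR) s₀ s₂ e₀ e₂ := by
  have := comp_pair_comp (.single χ) σ (.single φ) τ (vid (𝟙 Q)) e₀ e₁ e₂ hP rfl hR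
    (CellPath.cast_cons ..) (Category.comp_id s₀) (Category.comp_id s₂) (Category.comp_id u) (Category.comp_id w)
  exact this

/-- A pair consisting of a cell and a nullary cell, composed with a nullary cell. -/
theorem hcomp_vcomp_vid {A B X Y Z Q : Ob} {K : HTarget (Ob := Ob) Hor A B}
    {u : A ⟶ Q} {v : B ⟶ Q} {I : HPath (Ob := Ob) Hor X Y} {H : HPath (Ob := Ob) Hor Y Z}
    {P : HPath (Ob := Ob) Hor X Z} {a : X ⟶ A} {b : Y ⟶ B} {c : Z ⟶ B}
    (χ : Cell I a b K) (σ : Cell K.toPath u v (.null Q)) (φ : Cell H b c (.null B))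
    {s₀ : X ⟶ Q} {s₁ : Y ⟶ Q} {s₂ : Z ⟶ Q}
    (e₀ : a ≫ u = s₀) (e₁ : b ≫ v = s₁) (e₂ : c ≫ v = s₂) (hP : P = I.append H) :
    hcomp (vcomp χ σ s₀ s₁ e₀ e₁) (vcomp φ (vid v) s₁ s₂ e₁ e₂) hP =
      comp (.cons χ (.single φ) hP (HPath.append_nil _).symm) σ s₀ s₂ e₀ e₂ := by
  rw [hcomp_vcomp χ σ φ (K' := .null B) (vid v) e₀ e₁ e₂ hP (HPath.append_nil _).symm, hcomp_vid]

/-- Dropping the identity cell leaves the empty path, which is `idPath` of the empty horizontal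
path, so the unit law `comp_id` applies. -/
theorem vid_id_vcomp {B C D : Ob} {K : HTarget (Ob := Ob) Hor C D} {f : B ⟶ C} {g : B ⟶ D}
    (φ : Cell (.nil B) f g K) (hs : 𝟙 B ≫ f = f) (ht : 𝟙 B ≫ g = g) :
    vcomp (K := .null B) (vid (𝟙 B)) φ f g hs ht = φ :=
  (comp_vid (.nil (𝟙 B)) (.nil (𝟙 B)) φ f g hs ht).trans (comp_id φ)

/-- Postcomposition with a vertical morphism preserves horizontal composition. -/
theorem hcomp_whisker {X Y Z B Q : Ob} {I : HPath (Ob := Ob) Hor X Y}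
    {H : HPath (Ob := Ob) Hor Y Z} {P : HPath (Ob := Ob) Hor X Z} {a : X ⟶ B} {b : Y ⟶ B}
    {c : Z ⟶ B} {v : B ⟶ Q} (χ : Cell I a b (.null B)) (φ : Cell H b c (.null B))
    {s₀ : X ⟶ Q} {s₁ : Y ⟶ Q} {s₂ : Z ⟶ Q} (e₀ : a ≫ v = s₀) (e₁ : b ≫ v = s₁)
    (e₂ : c ≫ v = s₂) (hP : P = I.append H) :
    vcomp (hcomp χ φ hP) (vid v) s₀ s₂ e₀ e₂ =
      hcomp (vcomp χ (vid v) s₀ s₁ e₀ e₁) (vcomp φ (vid v) s₁ s₂ e₁ e₂) hP := by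
  rw [hcomp_vcomp_vid χ (K := .null B) (vid v) φ]
  refine (comp_single_comp (.cons χ (.single φ) hP rfl) (vid (𝟙 B)) (vid v)
    (Category.comp_id a) (Category.comp_id c) e₀ e₂ (Category.id_comp v)
    (Category.id_comp v)).trans ?_
  exact congrArg (fun σ => comp (.cons χ (.single φ) hP rfl) σ s₀ s₂ e₀ e₂)
    (vid_id_vcomp (vid v) (Category.id_comp v) (Category.id_comp v))

/-- Interchange: a cell followed by a whiskered vertical cell. -/
theorem hcomp_vcomp_vid_left {X Y P Q : Ob} {H : HPath (Ob := Ob) Hor X Y} {a : X ⟶ P} {b : Y ⟶ P}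
    {p q : P ⟶ Q} (φ : Cell H a b (.null P)) (ι : VCell p q) {s : X ⟶ Q} {m : Y ⟶ Q} {t : Y ⟶ Q}
    (hs : a ≫ p = s) (hm : b ≫ p = m) (ht : b ≫ q = t) (hP : H = H.append (.nil Y)) :
    hcomp (vcomp φ (vid p) s m hs hm) (vcomp (vid b) ι m t hm ht) hP = vcomp φ ι s t hs ht := by
  rw [hcomp_vcomp φ (K := .null P) (vid p) (vid b) (K' := .null P) ι hs hm ht hP (HPath.nil_append _), vid_hcomp]
  exact comp_cons_vid (K := .null P) ..

/-- Interchange: a whiskered vertical cell followed by a cell. -/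
theorem hcomp_vcomp_vid_right {X Y P Q : Ob} {H : HPath (Ob := Ob) Hor X Y} {a : X ⟶ P} {b : Y ⟶ P}
    {p q : P ⟶ Q} (φ : Cell H a b (.null P)) (ι : VCell p q) {s : X ⟶ Q} {m : X ⟶ Q} {t : Y ⟶ Q}
    (hs : a ≫ p = s) (hm : a ≫ q = m) (ht : b ≫ q = t) :
    hcomp (vcomp (vid a) ι s m hs hm) (vcomp φ (vid q) m t hm ht) (HPath.nil_append H) = vcomp φ ι s t hs ht := by
  rw [hcomp_vcomp_vid (vid a) (K := .null P) ι φ hs hm ht (HPath.nil_append H)]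
  exact comp_vid_cons (K := .null P) ..

/-- Precomposing a horizontal composite with a unary or nullary cell. -/
theorem vcomp_hcomp {A B X Y Q : Ob} {K : HTarget (Ob := Ob) Hor A B}
    {u : A ⟶ Q} {v w : B ⟶ Q} {I : HPath (Ob := Ob) Hor X Y} {a : X ⟶ A} {b : Y ⟶ B}
    (χ : Cell I a b K) (σ : Cell K.toPath u v (.null Q)) (τ : VCell v w)
    {s₀ : X ⟶ Q} {s₁ : Y ⟶ Q} {s₂ : Y ⟶ Q}
    (e₀ : a ≫ u = s₀) (e₁ : b ≫ v = s₁) (e₂ : b ≫ w = s₂)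
    (hK : K.toPath = K.toPath.append (.nil B)) (hI : I = I.append (.nil Y)) :
    vcomp χ (hcomp σ τ hK) s₀ s₂ e₀ e₂ =
      hcomp (vcomp χ σ s₀ s₁ e₀ e₁) (vcomp (vid b) τ s₁ s₂ e₁ e₂) hI := by
  rw [hcomp_vcomp χ σ (K' := .null B) (vid b) τ e₀ e₁ e₂ hI hK]
  exact (comp_cons_vid (K := K) ..).symm

theorem vid_vcomp_vid {A B C : Ob} (a : A ⟶ B) (b : B ⟶ C) {s : A ⟶ C} (hs : a ≫ b = s) :
    vcomp (vid a) (vid b) s s hs hs = vid s := by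
  subst hs
  exact vid_comp a b

/-! ### Cartesian cells -/

theorem IsCartesian.existsUnique {A B C D X Y : Ob} {J : HTarget (Ob := Ob) Hor A B} {f : A ⟶ C}
    {g : B ⟶ D} {K : HTarget (Ob := Ob) Hor C D} {ψ : Cell J.toPath f g K} (hψ : IsCartesian ψ)
    {H : HPath (Ob := Ob) Hor X Y} {h : X ⟶ A} {k : Y ⟶ B} {s : X ⟶ C} {t : Y ⟶ D}
    (hs : h ≫ f = s) (ht : k ≫ g = t) (χ : Cell H s t K) :
    ∃! φ : Cell H h k J, vcomp φ ψ s t hs ht = χ := by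
  subst hs ht
  exact hψ H h k χ

theorem IsCartesian.vcomp {A B C D E F : Ob} {J : HTarget (Ob := Ob) Hor A B} {f : A ⟶ C}
    {g : B ⟶ D} {K : HTarget (Ob := Ob) Hor C D} {p : C ⟶ E} {q : D ⟶ F}
    {L : HTarget (Ob := Ob) Hor E F} {c : Cell J.toPath f g K} {ψ : Cell K.toPath p q L}
    (hc : IsCartesian c) (hψ : IsCartesian ψ) {s : A ⟶ E} {t : B ⟶ F} (hs : f ≫ p = s)
    (ht : g ≫ q = t) : IsCartesian (vcomp c ψ s t hs ht) := by
  subst hs ht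
  intro X Y H h k χ
  obtain ⟨σ, hσ, hσ'⟩ := hψ.existsUnique (Category.assoc h f p) (Category.assoc k g q) χ
  obtain ⟨τ, hτ, hτ'⟩ := hc H h k σ
  refine ⟨τ, ?_, fun τ' h' => hτ' _ (hσ' _ ?_)⟩
  · simp only
    rw [← vcomp_assoc (hs := rfl) (ht := rfl) (hs' := Category.assoc h f p)
      (ht' := Category.assoc k g q), hτ, hσ]
  · simp only at h' ⊢
    rw [← h', vcomp_assoc]

theorem IsCartesian.of_vcomp {A B C D E F : Ob} {J : HTarget (Ob := Ob) Hor A B} {f : A ⟶ C}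
    {g : B ⟶ D} {K : HTarget (Ob := Ob) Hor C D} {p : C ⟶ E} {q : D ⟶ F}
    {L : HTarget (Ob := Ob) Hor E F} {c : Cell J.toPath f g K} {ψ : Cell K.toPath p q L}
    (hψ : IsCartesian ψ) {s : A ⟶ E} {t : B ⟶ F} {hs : f ≫ p = s}
    {ht : g ≫ q = t} (hc : IsCartesian (AVDC.vcomp c ψ s t hs ht)) : IsCartesian c := by
  subst hs ht
  intro X Y H h k χ
  obtain ⟨τ, hτ, hτ'⟩ := hc H h k
    (AVDC.vcomp χ ψ _ _ (Category.assoc h f p) (Category.assoc k g q))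
  refine ⟨τ, ?_, fun τ' h' => hτ' _ ?_⟩
  · refine (hψ.existsUnique (Category.assoc h f p) (Category.assoc k g q) _).unique ?_ rfl
    rw [vcomp_assoc]
    exact hτ
  · simp only at h' ⊢
    rw [← h', vcomp_assoc]

/-! ### Kan cells -/

/-- Cells with horizontal source `J ⌢ H` and the vertical source of `η` factor uniquely
through `η`. -/
def IsKanAlong {A B M Y : Ob} {J : HPath (Ob := Ob) Hor A B} {d : A ⟶ M} {l : B ⟶ M}
    (η : Cell J d l (.null M)) (H : HPath (Ob := Ob) Hor B Y) : Prop :=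
  ∀ (k : Y ⟶ M) (φ : Cell (J.append H) d k (.null M)), ∃! φ' : Cell H l k (.null M),
    hcomp η φ' rfl = φ

/-- Being left Kan is `IsKanAlong` for all `H`, being weakly left Kan is `IsKanAlong` for the empty
path. A transfer that works for each `H` separately therefore settles both variants. -/
theorem IsKan.of_isKanAlong {κ : Variant} {A B M N : Ob} {J : Hor A B} {d : A ⟶ M}
    {l : B ⟶ M} {d' : A ⟶ N} {l' : B ⟶ N} {γ : NullaryCell J d l} {η : NullaryCell J d' l'}
    (h : ∀ (Y : Ob) (H : HPath (Ob := Ob) Hor B Y), IsKanAlong γ H → IsKanAlong η H)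
    (hγ : IsKan κ γ) : IsKan κ η :=
  match κ, hγ with
  | .ordinary, hγ => fun {Y} H => h Y H (hγ H)
  | .weak, hγ => h B (.nil B) hγ

theorem IsKan.isWeaklyLeftKan {κ : Variant} {A B M : Ob} {J : Hor A B} {d : A ⟶ M}
    {l : B ⟶ M} {η : NullaryCell J d l} (hη : IsKan κ η) : IsWeaklyLeftKan η :=
  match κ, hη with
  | .ordinary, hη => hη (.nil B)
  | .weak, hη => hη

theorem IsWeaklyLeftKan.hcomp_of_inverse {A B M : Ob} {J : HPath (Ob := Ob) Hor A B} {d : A ⟶ M}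
    {l m : B ⟶ M} {η : Cell J d l (.null M)} (hη : IsWeaklyLeftKan η) {α : VCell l m}
    {β : VCell m l} (hαβ : hcomp α β (HPath.nil_append _) = vid l) (hβα : hcomp β α (HPath.nil_append _) = vid m) :
    IsWeaklyLeftKan (hcomp η α (HPath.append_nil J).symm) := by
  intro k φ
  obtain ⟨ξ, hξ, hξ'⟩ := hη k φ
  refine ⟨hcomp β ξ (HPath.nil_append _), ?_, fun ξ' h' => ?_⟩
  · simp only
    rw [hcomp_assoc (hQ := HPath.nil_append _) (hR' := (HPath.append_nil J).symm),
      ← hcomp_assoc α β ξ (HPath.nil_append _) (HPath.nil_append _) (HPath.nil_append _)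
        (HPath.nil_append _), hαβ, vid_hcomp, hξ]
  · rw [← hξ' (hcomp α ξ' (HPath.nil_append _)), ← hcomp_assoc β α ξ' (HPath.nil_append _) (HPath.nil_append _)
      (HPath.nil_append _) (HPath.nil_append _), hβα, vid_hcomp]
    simp only at h' ⊢
    rw [← h', hcomp_assoc (hQ := HPath.nil_append _) (hR' := (HPath.append_nil J).symm)]

/-! ### Transposition along a companion and a restriction of it -/

/-- The cells `χ : H ⇒ N` and `θ : H ⇒ P` factor through `cf` and `γ` respectively, by means of
the same cell `H ⇒ K`. -/
def IsTranspose {M N P Y : Ob} {K : Hor M N} {f : M ⟶ N} {y : M ⟶ P} {g : N ⟶ P}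
    (cf : NullaryCell K f (𝟙 N)) (γ : NullaryCell K y g) {H : HPath (Ob := Ob) Hor M Y}
    {k : Y ⟶ N} {t : Y ⟶ P} (ht : k ≫ g = t) (χ : Cell H f k (.null N))
    (θ : Cell H y t (.null P)) : Prop :=
  ∃ σ : Cell H (𝟙 M) k (.un K),
    vcomp σ cf f k (Category.id_comp f) (Category.comp_id k) = χ ∧
      vcomp σ γ y t (Category.id_comp y) ht = θ

namespace IsTranspose

variable {M N P Y : Ob} {K : Hor M N} {f : M ⟶ N} {y : M ⟶ P} {g : N ⟶ P}
    {cf : NullaryCell K f (𝟙 N)} {γ : NullaryCell K y g} {H : HPath (Ob := Ob) Hor M Y}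
    {k : Y ⟶ N} {t : Y ⟶ P} {ht : k ≫ g = t}

/-- With the three lemmas that follow, this makes transposition a bijection when both `cf` and `γ`
are cartesian. -/
theorem exists_left (hγ : IsNullaryCartesian γ) (ht : k ≫ g = t) (θ : Cell H y t (.null P)) :
    ∃ χ, IsTranspose cf γ ht χ θ :=
  have ⟨σ, hσ, _⟩ := IsCartesian.existsUnique (J := .un K) hγ (Category.id_comp y) ht θ
  ⟨_, σ, rfl, hσ⟩

theorem exists_right (hcf : IsNullaryCartesian cf) (ht : k ≫ g = t) (χ : Cell H f k (.null N)) :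
    ∃ θ, IsTranspose cf γ ht χ θ :=
  have ⟨σ, hσ, _⟩ := IsCartesian.existsUnique (J := .un K) hcf (Category.id_comp f)
    (Category.comp_id k) χ
  ⟨_, σ, hσ, rfl⟩

theorem unique_left (hγ : IsNullaryCartesian γ) {χ χ' : Cell H f k (.null N)}
    {θ : Cell H y t (.null P)} (h : IsTranspose cf γ ht χ θ) (h' : IsTranspose cf γ ht χ' θ) :
    χ = χ' := by
  obtain ⟨σ, rfl, hσ⟩ := h
  obtain ⟨σ', rfl, hσ'⟩ := h'
  rw [(IsCartesian.existsUnique (J := .un K) hγ (Category.id_comp y) ht θ).unique hσ hσ']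

theorem unique_right (hcf : IsNullaryCartesian cf) {χ : Cell H f k (.null N)}
    {θ θ' : Cell H y t (.null P)} (h : IsTranspose cf γ ht χ θ) (h' : IsTranspose cf γ ht χ θ') :
    θ = θ' := by
  obtain ⟨σ, hσ, rfl⟩ := h
  obtain ⟨σ', hσ', rfl⟩ := h'
  rw [(IsCartesian.existsUnique (J := .un K) hcf (Category.id_comp f) (Category.comp_id k)
    χ).unique hσ hσ']

theorem self (cf : NullaryCell K f (𝟙 N)) (γ : NullaryCell K y g) (ht : 𝟙 N ≫ g = g) :
    IsTranspose cf γ ht cf γ :=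
  ⟨hid K, hid_vcomp .., hid_vcomp ..⟩

theorem hcomp {Z : Ob} {χ : Cell H f k (.null N)} {θ : Cell H y t (.null P)}
    (h : IsTranspose cf γ ht χ θ) {I : HPath (Ob := Ob) Hor Y Z} {Q : HPath (Ob := Ob) Hor M Z}
    {l : Z ⟶ N} {r : Z ⟶ P} (φ : Cell I k l (.null N)) (hr : l ≫ g = r) (hQ : Q = H.append I) :
    IsTranspose cf γ hr (hcomp χ φ hQ) (hcomp θ (vcomp φ (vid g) t r ht hr) hQ) := by
  obtain ⟨σ, rfl, rfl⟩ := h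
  -- The mediating cell is `id_K ∘ (σ, φ)`, with the nullary `φ` attached on the right of `σ`.
  refine ⟨comp (.cons σ (.single φ) hQ rfl) (hid K) (𝟙 M) l (Category.comp_id _)
    (Category.comp_id _), ?_, ?_⟩
  · have e := hcomp_vcomp_vid σ (K := .un K) cf φ (Category.id_comp f) (Category.comp_id k)
      (Category.comp_id l) hQ
    rw [vcomp_vid_id] at e
    refine .trans ?_ e.symm
    exact (comp_single_comp (.cons σ (.single φ) hQ rfl) (hid K) cf _ _ _ _ (Category.id_comp f)
      (Category.id_comp _)).trans
      (congrArg (fun τ => comp (.cons σ (.single φ) hQ rfl) τ f l _ _) (hid_vcomp cf _ _))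
  · refine .trans ?_ (hcomp_vcomp_vid σ (K := .un K) γ φ (Category.id_comp y) ht hr hQ).symm
    exact (comp_single_comp (.cons σ (.single φ) hQ rfl) (hid K) γ _ _ _ _ (Category.id_comp y)
      (Category.id_comp _)).trans
      (congrArg (fun τ => comp (.cons σ (.single φ) hQ rfl) τ y r _ _) (hid_vcomp γ _ _))

theorem vcomp {X : Ob} {J : HTarget (Ob := Ob) Hor M Y} {χ : Cell J.toPath f k (.null N)}
    {θ : Cell J.toPath y t (.null P)} (h : IsTranspose cf γ ht χ θ)
    {I : HPath (Ob := Ob) Hor M X} {b : X ⟶ Y} (c : Cell I (𝟙 M) b J) {l : X ⟶ N} {r : X ⟶ P}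
    (hl : b ≫ k = l) (hr : l ≫ g = r) :
    IsTranspose cf γ hr (vcomp c χ f l (Category.id_comp f) hl)
      (vcomp c θ y r (Category.id_comp y) (by rw [← ht, ← hr, ← hl, Category.assoc])) := by
  obtain ⟨σ, rfl, rfl⟩ := h
  exact ⟨AVDC.vcomp c σ (𝟙 M) l (Category.id_comp _) hl, vcomp_assoc .., vcomp_assoc ..⟩

end IsTranspose

/-! ### Mates -/

section Mates

variable {N P : Ob} {z : P ⟶ N} {g : N ⟶ P} {ι : VCell (𝟙 P) (z ≫ g)} {ε : VCell (g ≫ z) (𝟙 N)}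
  {A B : Ob} {H : HPath (Ob := Ob) Hor A B} {a : A ⟶ P} {k : B ⟶ N} {s : A ⟶ N} {r : A ⟶ P}
  {t : B ⟶ P} {q : B ⟶ N}

/-- The mate of `ψ` is `ψ` whiskered by `z`, followed by the counit at `k`. Whiskering it by `g` and
prefixing the unit at `a`, interchange slides the unit past `ψ`, where it meets the counit and `tri`
cancels the two. -/
theorem hcomp_unit_hcomp_counit
    (tri : hcomp (vcomp (vid g) ι g (g ≫ z ≫ g)) (vcomp ε (vid g) (g ≫ z ≫ g) g) (HPath.nil_append _) = vid g)
    (hs : a ≫ z = s) (hr : s ≫ g = r) (ht : k ≫ g = t) (hq : t ≫ z = q) (ψ : Cell H a t (.null P))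
    (hr' : a ≫ z ≫ g = r) (hq' : k ≫ g ≫ z = q) (hH : H = H.append (.nil B)) :
    hcomp (vcomp (vid a) ι a r (Category.comp_id a) hr')
      (vcomp (hcomp (vcomp ψ (vid z) s q hs hq) (vcomp (vid k) ε q k hq' (Category.comp_id k)) hH)
        (vid g) r t hr ht) (HPath.nil_append H) = ψ := by
  have hqg : t ≫ z ≫ g = q ≫ g := by rw [← hq, Category.assoc]
  have hkg : k ≫ g ≫ z ≫ g = q ≫ g := by rw [← hq', Category.assoc, Category.assoc]
  have e₁ : vcomp (vcomp ψ (vid z) s q hs hq) (vid g) r (q ≫ g) hr rfl =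
      vcomp ψ (vid (z ≫ g)) r (q ≫ g) hr' hqg := by
    rw [vcomp_assoc (hm := rfl) (hn := rfl), vid_vcomp_vid]
  have e₂ : vcomp (vid t) ι t (q ≫ g) (Category.comp_id t) hqg =
      vcomp (vid k) (vcomp (vid g) ι g (g ≫ z ≫ g)) t (q ≫ g) ht hkg := by
    rw [← vid_vcomp_vid k g ht, vcomp_assoc]
  have e₃ : vcomp (vcomp (vid k) ε q k hq' (Category.comp_id k)) (vid g) (q ≫ g) t rfl ht =
      vcomp (vid k) (vcomp ε (vid g) (g ≫ z ≫ g) g) (q ≫ g) t hkg ht := by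
    rw [vcomp_assoc]
  have e₄ := hcomp_vcomp_vid_left ψ ι (Category.comp_id a) (Category.comp_id t) hqg hH
  rw [vcomp_vid_id] at e₄
  rw [hcomp_whisker (e₁ := rfl), ← hcomp_assoc (hP := HPath.nil_append _) (hR := hH), e₁,
    hcomp_vcomp_vid_right ψ ι (Category.comp_id a) hr' hqg, ← e₄,
    hcomp_assoc (hQ := HPath.nil_append _) (hR' := hH), e₂, e₃,
    ← vcomp_hcomp (vid k) (K := .null N) (vcomp (vid g) ι g (g ≫ z ≫ g))
      (vcomp ε (vid g) (g ≫ z ≫ g) g) ht hkg ht (HPath.nil_append _) (HPath.nil_append _), tri, vid_vcomp_vid, hcomp_vid]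

theorem hcomp_counit_hcomp_unit
    (tri : hcomp (vcomp ι (vid z) z (z ≫ g ≫ z)) (vcomp (vid z) ε (z ≫ g ≫ z) z) (HPath.nil_append _) = vid z)
    (hs : a ≫ z = s) (hr : s ≫ g = r) (ht : k ≫ g = t) (hq : t ≫ z = q) (φ : Cell H s k (.null N))
    (hr' : a ≫ z ≫ g = r) (hq' : k ≫ g ≫ z = q) (hH : H = H.append (.nil B)) :
    hcomp (vcomp (hcomp (vcomp (vid a) ι a r (Category.comp_id a) hr')
      (vcomp φ (vid g) r t hr ht) (HPath.nil_append H)) (vid z) s q hs hq)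
        (vcomp (vid k) ε q k hq' (Category.comp_id k)) hH = φ := by
  have hrz : s ≫ g ≫ z = r ≫ z := by rw [← hr, Category.assoc]
  have haz : a ≫ z ≫ g ≫ z = r ≫ z := by rw [← hr', Category.assoc, Category.assoc]
  have e₁ : vcomp (vcomp φ (vid g) r t hr ht) (vid z) (r ≫ z) q rfl hq =
      vcomp φ (vid (g ≫ z)) (r ≫ z) q hrz hq' := by
    rw [vcomp_assoc (hm := rfl) (hn := rfl), vid_vcomp_vid]
  have e₂ : vcomp (vid s) ε (r ≫ z) s hrz (Category.comp_id s) =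
      vcomp (vid a) (vcomp (vid z) ε (z ≫ g ≫ z) z) (r ≫ z) s haz hs := by
    rw [← vid_vcomp_vid a z hs, vcomp_assoc]
  have e₃ : vcomp (vcomp (vid a) ι a r (Category.comp_id a) hr') (vid z) s (r ≫ z) hs rfl =
      vcomp (vid a) (vcomp ι (vid z) z (z ≫ g ≫ z)) s (r ≫ z) hs haz := by
    rw [vcomp_assoc]
  have e₄ := hcomp_vcomp_vid_right φ ε hrz (Category.comp_id s) (Category.comp_id k)
  rw [vcomp_vid_id] at e₄
  rw [hcomp_whisker (e₁ := rfl), hcomp_assoc (hQ := hH) (hR' := HPath.nil_append _), e₁,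
    hcomp_vcomp_vid_left φ ε hrz hq' (Category.comp_id k) hH, ← e₄,
    ← hcomp_assoc (hP := HPath.nil_append _) (hR := HPath.nil_append _), e₂, e₃,
    ← vcomp_hcomp (vid a) (K := .null P) (vcomp ι (vid z) z (z ≫ g ≫ z))
      (vcomp (vid z) ε (z ≫ g ≫ z) z) hs haz hs (HPath.nil_append _) (HPath.nil_append _), tri, vid_vcomp_vid, vid_hcomp]

end Mates

/-- Transposing along an adjunction preserves the universal property of Kan cells. -/
theorem IsKanAlong.of_isTranspose {M N P B Y : Ob} {K : Hor M N} {f : M ⟶ N} {y : M ⟶ P}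
    {g : N ⟶ P} {cf : NullaryCell K f (𝟙 N)} {γ : NullaryCell K y g} (hcf : IsNullaryCartesian cf)
    (hγ : IsNullaryCartesian γ) {z : P ⟶ N} {ι : VCell (𝟙 P) (z ≫ g)} {ε : VCell (g ≫ z) (𝟙 N)}
    (tri₁ : hcomp (vcomp (vid g) ι g (g ≫ z ≫ g)) (vcomp ε (vid g) (g ≫ z ≫ g) g) (HPath.nil_append _) = vid g)
    (tri₂ : hcomp (vcomp ι (vid z) z (z ≫ g ≫ z)) (vcomp (vid z) ε (z ≫ g ≫ z) z) (HPath.nil_append _) = vid z)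
    {J : HPath (Ob := Ob) Hor M B} {a : B ⟶ P} {s : B ⟶ N} {r : B ⟶ P} {δ : Cell J y a (.null P)}
    {η : Cell J f s (.null N)} (hs : a ≫ z = s) (hr : s ≫ g = r) (hr' : a ≫ z ≫ g = r)
    (hη : IsTranspose cf γ hr η
      (hcomp δ (vcomp (vid a) ι a r (Category.comp_id a) hr') (HPath.append_nil J).symm))
    {H : HPath (Ob := Ob) Hor B Y} (hδ : IsKanAlong δ H) : IsKanAlong η H := by
  intro k χ
  have hk : k ≫ g ≫ z = (k ≫ g) ≫ z := (Category.assoc k g z).symm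
  have hH := (HPath.append_nil H).symm
  obtain ⟨θ, hθ⟩ := IsTranspose.exists_right (γ := γ) hcf (rfl : k ≫ g = k ≫ g) χ
  obtain ⟨ψ, hψ, hψ'⟩ := hδ _ θ
  -- By naturality and reassociation, `η ⊙ φ` transposes to `δ` followed by the mate of `φ`. So
  -- factoring `χ` through `η` amounts to factoring its transpose `θ` through `δ`.
  have key (φ : Cell H s k (.null N)) := hη.hcomp φ (rfl : k ≫ g = k ≫ g) rfl
  simp only [hcomp_assoc δ _ _ _ _ (HPath.nil_append _) rfl] at key
  refine ⟨hcomp (vcomp ψ (vid z) s _ hs rfl) (vcomp (vid k) ε _ k hk (Category.comp_id k)) hH,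
    ?_, fun φ hφ => ?_⟩
  · have := key (hcomp (vcomp ψ (vid z) s _ hs rfl)
      (vcomp (vid k) ε _ k hk (Category.comp_id k)) hH)
    rw [hcomp_unit_hcomp_counit tri₁ hs hr rfl rfl ψ hr' hk hH, hψ] at this
    exact this.unique_left hγ hθ
  · have := key φ
    simp only at hφ
    rw [hφ] at this
    rw [← hψ' _ (this.unique_right hcf hθ)]
    exact (hcomp_counit_hcomp_unit tri₂ hs hr rfl rfl φ hr' hk hH).symm

/-- Two weakly left Kan cells `ζ`, `η` on the same data differ by an invertible vertical cell, and
whiskering by `b` keeps it invertible. Hence restriction along `f`, which concerns all Kan cells,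
can be tested on one. -/
theorem IsWeaklyLeftKan.vcomp_of_vcomp {A B M X Y : Ob} {J : HTarget (Ob := Ob) Hor A B}
    {d : A ⟶ M} {l m : B ⟶ M} {ζ : Cell J.toPath d l (.null M)} {η : Cell J.toPath d m (.null M)}
    (hζ : IsWeaklyLeftKan ζ) (hη : IsWeaklyLeftKan η) {I : HPath (Ob := Ob) Hor X Y} {a : X ⟶ A}
    {b : Y ⟶ B} {c : Cell I a b J} {s : X ⟶ M} {t t' : Y ⟶ M} {hs : a ≫ d = s} {ht : b ≫ l = t}
    (ht' : b ≫ m = t') (hc : IsWeaklyLeftKan (vcomp c ζ s t hs ht)) :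
    IsWeaklyLeftKan (vcomp c η s t' hs ht') := by
  have inv {l m : B ⟶ M} {ζ : Cell J.toPath d l (.null M)} {η : Cell J.toPath d m (.null M)}
      (hζ : IsWeaklyLeftKan ζ) {α : VCell l m} {β : VCell m l}
      (hα : hcomp ζ α (HPath.append_nil _).symm = η)
      (hβ : hcomp η β (HPath.append_nil _).symm = ζ) {t t' : Y ⟶ M} (ht : b ≫ l = t)
      (ht' : b ≫ m = t') :
      hcomp (vcomp (vid b) α t t' ht ht') (vcomp (vid b) β t' t ht' ht) (HPath.nil_append _) =
        vid t := by
    have : hcomp α β (HPath.nil_append _) = vid l := by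
      refine (hζ l ζ).unique ?_ (hcomp_vid _ _)
      rw [← hcomp_assoc (hP := (HPath.append_nil _).symm) (hR := (HPath.append_nil _).symm), hα, hβ]
    rw [← vcomp_hcomp (vid b) (K := .null B) α β ht ht' ht (HPath.nil_append _)
      (HPath.nil_append _), this, vid_vcomp_vid]
  obtain ⟨α, hα, _⟩ := hζ m η
  obtain ⟨β, hβ, _⟩ := hη l ζ
  have := hc.hcomp_of_inverse (inv hζ hα hβ ht ht') (inv hη hβ hα ht' ht)
  rwa [← vcomp_hcomp c ζ α hs ht ht' (HPath.append_nil _).symm, hα] at this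

/-! ### Left adjoints of $(f_*)^\lambda$ against Kan extensions of `f` along $y_*$. -/

section

variable {M N P : Ob} {f : M ⟶ N} {y : M ⟶ P} {g : N ⟶ P} {yStar : Hor M P} {fStar : Hor M N}
  {cy : NullaryCell yStar y (𝟙 P)} {cf : NullaryCell fStar f (𝟙 N)} {γ : NullaryCell fStar y g}

/-- The weak left Kan extension of `f` along the companion of `y` is left adjoint to `g` as soon as
it restricts along `g`. -/
theorem isLeftAdjointTo_of_isWeaklyLeftKan (hcf : IsNullaryCartesian cf)
    (hγ : IsNullaryCartesian γ) (hcy : IsWeaklyLeftKan cy) (hγ' : IsWeaklyLeftKan γ)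
    {c : UnaryCell fStar (𝟙 M) g yStar}
    (hc : vcomp c cy y g (Category.id_comp y) (Category.comp_id g) = γ) {z : P ⟶ N}
    {ζ : NullaryCell yStar f z} (hζ : IsWeaklyLeftKan ζ)
    (hcζ : IsWeaklyLeftKan (vcomp c ζ f (g ≫ z))) : IsLeftAdjointTo z g := by
  obtain ⟨θ, hθ⟩ := IsTranspose.exists_right (γ := γ) hcf (rfl : z ≫ g = z ≫ g) ζ
  -- The unit: `cy` has vertical target the identity of `P`, so the factor of `θ` starts there.
  obtain ⟨ι, hι, -⟩ := hcy _ θ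
  -- The counit: the restricted cell has vertical target `g ≫ z`, while `cf` ends at the identity of
  -- `N`.
  obtain ⟨ε, hε, -⟩ := hcζ _ cf
  have tri₁ : hcomp (vcomp (vid g) ι g (g ≫ z ≫ g)) (vcomp ε (vid g) (g ≫ z ≫ g) g)
      (HPath.nil_append _) = vid g := by
    refine (hγ' g γ).unique ?_ (hcomp_vid _ _)
    -- Transpose the equation `hε`: its right side `cf` becomes `γ`, its left side `γ` followed by
    -- the triangle composite.
    have := (hθ.vcomp (J := .un yStar) c (rfl : g ≫ z = g ≫ z) (Category.assoc _ _ _)).hcomp ε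
      (Category.id_comp g) (HPath.append_nil _).symm
    rw [hε] at this
    refine .trans ?_ (this.unique_right hcf (IsTranspose.self cf γ _))
    rw [← hι, vcomp_hcomp c (K := .un yStar) cy ι (Category.id_comp y) (Category.comp_id g)
      rfl _ (HPath.append_nil _).symm, hc, hcomp_assoc (hQ := HPath.nil_append _)
      (hR' := (HPath.append_nil _).symm)]
  refine ⟨ι, ε, tri₁, ?_⟩
  refine (hζ z ζ).unique ?_ (hcomp_vid _ _)
  -- The second triangle composite is the mate of `ι`. By the first triangle identity, appending it
  -- to `ζ` leaves the transpose `θ` unchanged.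
  have := hθ.hcomp (hcomp (vcomp ι (vid z) z (z ≫ g ≫ z)) (vcomp (vid z) ε (z ≫ g ≫ z) z)
    (HPath.nil_append _)) rfl (HPath.append_nil _).symm
  have e := hcomp_unit_hcomp_counit tri₁ (Category.id_comp z) rfl rfl (Category.assoc z g z) ι
    (Category.id_comp _) rfl (HPath.nil_append _)
  rw [vid_id_vcomp] at e
  rw [← hι, hcomp_assoc (hQ := HPath.nil_append _) (hR' := (HPath.append_nil _).symm), e, hι] at this
  exact this.unique_left hγ hθ

/-- A left adjoint of `g` is the pointwise left Kan extension of `f` along the companion of `y`. -/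
theorem IsLeftAdjointTo.exists_isKan {κ : Variant} (hy : IsDense κ y) (hcy : IsNullaryCartesian cy)
    (hcf : IsNullaryCartesian cf) (hγ : IsNullaryCartesian γ) {z : P ⟶ N}
    (hz : IsLeftAdjointTo z g) : ∃ ζ : NullaryCell yStar f z, ∀ (B : Ob) (a : B ⟶ P) (s : B ⟶ N)
      (hs : a ≫ z = s) (J : Hor M B) (c : UnaryCell J (𝟙 M) a yStar), IsUnaryCartesian c →
        IsKan κ (vcomp c ζ f s (Category.id_comp f) hs) := by
  obtain ⟨ι, ε, tri₁, tri₂⟩ := hz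
  obtain ⟨ζ, hζ⟩ := IsTranspose.exists_left (cf := cf) hγ rfl
    (hcomp cy ι (HPath.append_nil _).symm)
  refine ⟨ζ, fun B a s hs J c hc => ?_⟩
  subst hs
  -- A cartesian cell out of `y`, hence Kan by density; the adjunction transports this to `ζ`
  -- restricted along `a`.
  have hcc : IsNullaryCartesian (vcomp c cy y a (Category.id_comp y) (Category.comp_id a)) :=
    IsCartesian.vcomp (J := .un J) (K := .un yStar) hc hcy _ _
  refine IsKan.of_isKanAlong (fun Y H hH => hH.of_isTranspose hcf hγ tri₁ tri₂ rfl
    (Category.assoc a z g) rfl ?_) (hy _ _ _ _ hcc)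
  have := hζ.vcomp (J := .un yStar) c (rfl : a ≫ z = a ≫ z) (Category.assoc a z g)
  rwa [vcomp_hcomp c (K := .un yStar) cy ι (Category.id_comp y) (Category.comp_id a)
    rfl _ (HPath.append_nil _).symm] at this

/-- Lets `ζ` itself be treated as its own restriction along the identity of `P`. -/
theorem isUnaryCartesian_hid (hcy : IsNullaryCartesian cy) : IsUnaryCartesian (hid yStar) :=
  IsCartesian.of_vcomp (J := .un yStar) (K := .un yStar) hcy (hs := Category.id_comp y)
    (ht := Category.id_comp _)
    (congrArg (fun ψ => IsNullaryCartesian ψ) (hid_vcomp cy _ _) |>.mpr hcy)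

theorem exists_isUnaryCartesian (hcy : IsNullaryCartesian cy) {B : Ob} {J : Hor M B} {a : B ⟶ P}
    {δ : NullaryCell J y a} (hδ : IsNullaryCartesian δ) :
    ∃ c : UnaryCell J (𝟙 M) a yStar, IsUnaryCartesian c ∧
      vcomp c cy y a (Category.id_comp y) (Category.comp_id a) = δ := by
  obtain ⟨c, hc, -⟩ := IsCartesian.existsUnique (J := .un yStar) hcy (Category.id_comp y)
    (Category.comp_id a) δ
  refine ⟨c, IsCartesian.of_vcomp (J := .un J) (K := .un yStar) hcy
    (hs := Category.id_comp y) (ht := Category.comp_id a)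
    (congrArg (fun ψ => IsNullaryCartesian ψ) hc |>.mpr hδ), hc⟩

theorem IsLeftAdjointTo.isTotalMorphism {κ : Variant} (hy : IsYoneda κ y)
    (hcy : IsNullaryCartesian cy) (hcf : IsNullaryCartesian cf) (hγ : IsNullaryCartesian γ)
    {z : P ⟶ N} (hz : IsLeftAdjointTo z g) : IsTotalMorphism κ f := by
  obtain ⟨ζ, hζ⟩ := hz.exists_isKan hy.dense hcy hcf hγ
  intro B J
  obtain ⟨a, δ, hδ⟩ := hy.yoneda B J
  obtain ⟨c, hc, -⟩ := exists_isUnaryCartesian hcy hδ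
  refine ⟨a ≫ z, vcomp c ζ f (a ≫ z), hζ _ _ _ rfl _ _ hc, fun {X} b J' c' hc' => ?_⟩
  -- A restriction of `J` along `b` is a restriction of `yStar` along `b ≫ a`, so pointwiseness is
  -- again an instance of `hζ`.
  rw [← vcomp_assoc (J := .single J') (K := .un J) (L := .un yStar) c' c ζ
    (Category.comp_id (𝟙 M)) (rfl : b ≫ a = b ≫ a) (Category.id_comp f) (Category.assoc b a z)]
  exact hζ _ _ _ (Category.assoc b a z) _ _
    (IsCartesian.vcomp (J := .un J') (K := .un J) (L := .un yStar) hc' hc _ _)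

theorem IsLeftAdjointTo.exists_isWeaklyLeftKan {κ : Variant} (hy : IsDense κ y)
    (hcy : IsNullaryCartesian cy) (hcf : IsNullaryCartesian cf) (hγ : IsNullaryCartesian γ)
    {z : P ⟶ N} (hz : IsLeftAdjointTo z g) :
    ∃ η : NullaryCell yStar f z, IsWeaklyLeftKan η := by
  obtain ⟨ζ, hζ⟩ := hz.exists_isKan hy hcy hcf hγ
  refine ⟨ζ, ?_⟩
  have := (hζ _ _ _ (Category.id_comp z) _ _ (isUnaryCartesian_hid hcy)).isWeaklyLeftKan
  rwa [hid_vcomp] at this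

theorem IsLeftAdjointTo.weakLeftKanRestrictsAlong {κ : Variant} (hy : IsDense κ y)
    (hcy : IsNullaryCartesian cy) (hcf : IsNullaryCartesian cf) (hγ : IsNullaryCartesian γ)
    {z : P ⟶ N} (hz : IsLeftAdjointTo z g) : WeakLeftKanRestrictsAlong f yStar g := by
  obtain ⟨ζ, hζ⟩ := hz.exists_isKan hy hcy hcf hγ
  have hζ' := (hζ _ _ _ (Category.id_comp z) _ _ (isUnaryCartesian_hid hcy)).isWeaklyLeftKan
  rw [hid_vcomp] at hζ'
  obtain ⟨c, hc, -⟩ := exists_isUnaryCartesian hcy hγ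
  exact ⟨⟨fStar, c, hc⟩, fun l η hη J' c' hc' =>
    IsWeaklyLeftKan.vcomp_of_vcomp (J := .un yStar) hζ' hη rfl
      (hζ _ _ _ rfl _ _ hc').isWeaklyLeftKan⟩

theorem WeakLeftKanRestrictsAlong.isLeftAdjointTo {κ : Variant} (hy : IsDense κ y)
    (hcy : IsNullaryCartesian cy) (hcf : IsNullaryCartesian cf) (hγ : IsNullaryCartesian γ)
    (h : WeakLeftKanRestrictsAlong f yStar g) {z : P ⟶ N} {η : NullaryCell yStar f z}
    (hη : IsWeaklyLeftKan η) : IsLeftAdjointTo z g := by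
  obtain ⟨c, hc, hcγ⟩ := exists_isUnaryCartesian hcy hγ
  exact isLeftAdjointTo_of_isWeaklyLeftKan hcf hγ (hy _ _ _ _ hcy).isWeaklyLeftKan
    (hy _ _ _ _ hγ).isWeaklyLeftKan hcγ hη (h.2 z η hη _ c hc)

theorem IsTotalMorphism.exists_isLeftAdjointTo {κ : Variant} (hf : IsTotalMorphism κ f)
    (hy : IsDense κ y) (hcy : IsNullaryCartesian cy) (hcf : IsNullaryCartesian cf)
    (hγ : IsNullaryCartesian γ) : ∃ z : P ⟶ N, IsLeftAdjointTo z g := by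
  obtain ⟨z, η, hη, hη'⟩ := hf P yStar
  obtain ⟨c, hc, hcγ⟩ := exists_isUnaryCartesian hcy hγ
  exact ⟨z, isLeftAdjointTo_of_isWeaklyLeftKan hcf hγ (hy _ _ _ _ hcy).isWeaklyLeftKan
    (hy _ _ _ _ hγ).isWeaklyLeftKan hcγ hη.isWeaklyLeftKan (hη' g _ c hc).isWeaklyLeftKan⟩

end

/-! ### Totality and exact cells. -/

theorem isPointwiseExact_hid (κ : Variant) {M N B : Ob} (f : M ⟶ N) (J : Hor M B) :
    IsPointwiseExact κ f (hid J) := by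
  intro l η hη
  -- Generalizing the boundary `𝟙 M ≫ f`, `𝟙 B ≫ l` allows it to be replaced by `f`, `l`.
  have (d : M ⟶ N) (m : B ⟶ N) (hd : 𝟙 M ≫ f = d) (hm : 𝟙 B ≫ l = m) :
      IsPointwiseKan κ (vcomp (hid J) η d m hd hm) := by
    obtain rfl : f = d := by rw [← hd, Category.id_comp]
    obtain rfl : l = m := by rw [← hm, Category.id_comp]
    rwa [hid_vcomp]
  exact this _ _ rfl rfl

theorem isTotalMorphism_iff (κ : Variant) {M N : Ob} (f : M ⟶ N) :
    IsTotalMorphism κ f ↔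
      ∀ (A B : Ob) (J : Hor A B) (d : A ⟶ M) (K : Hor M B) (φ : UnaryCell J d (𝟙 B) K),
        IsPointwiseExact κ f φ → PointwiseKanExists κ (d ≫ f) J := by
  refine ⟨fun hf A B J d K φ hφ => ?_, fun h B J => ?_⟩
  · obtain ⟨l, η, hη⟩ := hf B K
    exact ⟨_, _, hφ l η hη⟩
  · have := h M B J (𝟙 M) J (hid J) (isPointwiseExact_hid κ f J)
    rwa [Category.id_comp] at this

end

end AVDC

theorem mainTheorem8 {Ob : Type u} [Category.{v} Ob]
    [AugmentedVirtualDoubleCategory.{u, v, w, x} Ob] (κ : Variant) {M N : Ob} (f : M ⟶ N) :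
    (IsTotalMorphism κ f ↔
      ∀ (A B : Ob) (J : Cells.Hor A B) (d : A ⟶ M) (K : Cells.Hor M B)
        (φ : UnaryCell J d (𝟙 B) K), IsPointwiseExact κ f φ → PointwiseKanExists κ (d ≫ f) J) ∧
    ∀ {P : Ob} (y : M ⟶ P), IsYoneda κ y →
      ∀ (yStar : Cells.Hor M P) (cy : NullaryCell yStar y (𝟙 P)), IsCompanionCell cy →
      ∀ (fStar : Cells.Hor M N) (cf : NullaryCell fStar f (𝟙 N)), IsCompanionCell cf →
      ∀ (fl : N ⟶ P) (γ : NullaryCell fStar y fl), IsNullaryCartesian γ →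
        (IsTotalMorphism κ f ↔ WeakLeftKanExists f yStar ∧ WeakLeftKanRestrictsAlong f yStar fl) ∧
        (IsTotalMorphism κ f ↔ ∃ z : P ⟶ N, IsLeftAdjointTo z fl) ∧
        (IsTotalMorphism κ f → ∀ z : P ⟶ N,
          (∃ η : NullaryCell yStar f z, IsWeaklyLeftKan η) ↔ IsLeftAdjointTo z fl) := by
  refine ⟨isTotalMorphism_iff κ f, fun y hy yStar cy hcy fStar cf hcf fl γ hγ => ?_⟩
  have had (hf : IsTotalMorphism κ f) := hf.exists_isLeftAdjointTo hy.dense hcy hcf hγ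
  have hda : (∃ z : _ ⟶ N, IsLeftAdjointTo z fl) → IsTotalMorphism κ f :=
    fun ⟨_, hz⟩ => hz.isTotalMorphism hy hcy hcf hγ
  have hr (hf : IsTotalMorphism κ f) : WeakLeftKanRestrictsAlong f yStar fl :=
    have ⟨_, hz⟩ := had hf
    hz.weakLeftKanRestrictsAlong hy.dense hcy hcf hγ
  refine ⟨⟨fun hf => ⟨?_, hr hf⟩, fun ⟨⟨z, η, hη⟩, h⟩ =>
    hda ⟨z, h.isLeftAdjointTo hy.dense hcy hcf hγ hη⟩⟩, ⟨had, hda⟩, fun hf z =>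
    ⟨fun ⟨η, hη⟩ => (hr hf).isLeftAdjointTo hy.dense hcy hcf hγ hη,
      fun hz => hz.exists_isWeaklyLeftKan hy.dense hcy hcf hγ⟩⟩
  obtain ⟨z, hz⟩ := had hf
  exact ⟨z, hz.exists_isWeaklyLeftKan hy.dense hcy hcf hγ⟩
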